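/- Let $(X,d)$ be a complete separable metric space and let $E:X\to\mathbb R\cup\{+\infty\}$ be lower semicontinuous, bounded from below on every $d$-bounded set, with dense domain $D(E)=\{E<\infty\}$. Assume that for some $\lambda\in\mathbb R$ every $x\in X$ is the starting point of an $\mathrm{EVI}_\lambda$-gradient flow of $E$, that is, of a curve $(\gamma_t)_{t>0}$ in $AC_{loc}((0,\infty),X)$ with $\gamma_t\to x$ as $t\downarrow0$ such that, for every $y\in X$ and a.e. $t>0$, $$\tfrac12\tfrac{d}{dt}d^2(\gamma_t,y)+\tfrac\lambda2 d^2(\gamma_t,y)+E(\gamma_t)\le E(y).$$ Let $|\partial E|(x):=\limsup_{y\to x}[E(x)-E(y)]^+/d(x,y)$ for $x\in D(E)$ (equal to $0$ if $x$ is isolated), and $|\partial E|(x):=+\infty$ for $x\notin D(E)$. Assume that there is a Hausdorff topology $\sigma$ on $X$ such that every $d$-bounded sequence has a $\sigma$-convergent subsequence (with limit in $X$), and such that $d$ (jointly in its two arguments) and $|\partial E|$ are $\sigma$-sequentially lower semicontinuous. For a continuous curve $\gamma:[0,1]\to X$ and $\varepsilon>0$ let $$\mathcal A_\varepsilon(\gamma):=\frac12\int_0^1|\dot\gamma_t|^2\,dt+\frac{\varepsilon^2}{2}\int_0^1|\partial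 E|^2(\gamma_t)\,dt\in[0,+\infty],$$ where $|\dot\gamma_t|$ is the metric speed and the first term is $+\infty$ if $\gamma$ is not absolutely continuous. Then for all $x,y\in X$ and every $\varepsilon>0$ the following are equivalent: (a) the metric Schrödinger problem $\inf\{\mathcal A_\varepsilon(\gamma):\gamma\in C([0,1],X),\ \gamma_0=x,\ \gamma_1=y\}$ is solvable, i.e. its infimum is finite and attained; (b) $E(x)<\infty$, $E(y)<\infty$, and there is an absolutely continuous curve $\gamma:[0,1]\to X$ with $\gamma_0=x$ and $\gamma_1=y$. -/

import Mathlib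

open Set Filter Topology MeasureTheory
open scoped ENNReal

noncomputable section

namespace MetricSchrodinger

variable {X : Type*} [MetricSpace X]

/-- Absolute continuity of a curve on `[a, b]` with values in a metric space: the increments are
controlled by the integral of some `m ∈ L¹(a, b)`. Curves are functions on `ℝ`, of which only
the values on the relevant interval matter. -/
def ACOn (γ : ℝ → X) (a b : ℝ) : Prop :=
  ∃ m : ℝ → ℝ, IntegrableOn m (Icc a b) ∧
    ∀ s t : ℝ, a ≤ s → s ≤ t → t ≤ b → dist (γ s) (γ t) ≤ ∫ r in s..t, m r

/-- Local absolute continuity on `(0, ∞)`. -/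
def ACLoc (γ : ℝ → X) : Prop :=
  ∀ a b : ℝ, 0 < a → a < b → ACOn γ a b

/-- The metric speed `lim_{s → t} d(γ_s, γ_t) / |s - t|`. It is written with a `limsup`, which is the
limit whenever the limit exists, hence at almost every time along an absolutely continuous curve. -/
def metricSpeed (γ : ℝ → X) (t : ℝ) : ℝ≥0∞ :=
  limsup (fun s : ℝ => edist (γ s) (γ t) / edist s t) (𝓝[≠] t)

/-- The domain `D(E)`. -/
def domain (E : X → EReal) : Set X := {x | E x < ⊤}

open Classical in
/-- The slope `|∂E|`: it is `+∞` outside `D(E)`, and `limsup_{y → x} [E(x) - E(y)]⁺ / d(x, y)` at points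
of `D(E)` (with value `0` at isolated points, where the `limsup` is along the trivial filter).
`EReal.toENNReal` is the positive part. -/
def metricSlope (E : X → EReal) (x : X) : ℝ≥0∞ :=
  if x ∈ domain E then limsup (fun y : X => (E x - E y).toENNReal / edist x y) (𝓝[≠] x) else ⊤

/-- `γ` (on `t > 0`) is a gradient flow of `E` in the `EVI_lam` sense. Since `γ` is locally absolutely
continuous, the derivative of `t ↦ d²(γ_t, y)` exists at almost every time. -/
def IsEVIFlow (E : X → EReal) (lam : ℝ) (γ : ℝ → X) : Prop :=
  ACLoc γ ∧
    ∀ y : X, ∀ᵐ t ∂(volume.restrict (Ioi (0 : ℝ))), ∃ D : ℝ,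
      HasDerivAt (fun s : ℝ => dist (γ s) y ^ 2) D t ∧
        ((1 / 2 * D + lam / 2 * dist (γ t) y ^ 2 : ℝ) : EReal) + E (γ t) ≤ E y

/-- The curve `γ` (on `t > 0`) starts at `x`. -/
def StartsAt (E : X → EReal) (γ : ℝ → X) (x : X) : Prop :=
  x ∈ closure (domain E) ∧ Tendsto γ (𝓝[>] (0 : ℝ)) (𝓝 x)

/-- The standing assumptions on a functional `E : X → ℝ ∪ {+∞}` over the complete separable metric
space `X`. -/
structure Setting (E : X → EReal) : Prop where
  ne_bot : ∀ x, E x ≠ ⊥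
  lsc : LowerSemicontinuous E
  dense_domain : Dense (domain E)
  bounded_below : ∀ B : Set X, Bornology.IsBounded B → ∃ c : ℝ, ∀ x ∈ B, (c : EReal) ≤ E x
  flow : ∃ lam : ℝ, ∀ x : X, ∃ γ : ℝ → X, IsEVIFlow E lam γ ∧ StartsAt E γ x

/-- There is a Hausdorff topology `σ` on `X` for which `d`-bounded sequences have convergent
subsequences, and `d` and `|∂E|` are sequentially lower semicontinuous. -/
def WeakTopologyAssumption (E : X → EReal) : Prop :=
  ∃ σ : TopologicalSpace X,
    @T2Space X σ ∧
    (∀ u : ℕ → X, Bornology.IsBounded (range u) →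
      ∃ (z : X) (φ : ℕ → ℕ), StrictMono φ ∧ Tendsto (u ∘ φ) atTop (@nhds X σ z)) ∧
    (∀ (u v : ℕ → X) (x y : X), Tendsto u atTop (@nhds X σ x) → Tendsto v atTop (@nhds X σ y) →
      edist x y ≤ liminf (fun n => edist (u n) (v n)) atTop) ∧
    (∀ (u : ℕ → X) (x : X), Tendsto u atTop (@nhds X σ x) →
      metricSlope E x ≤ liminf (fun n => metricSlope E (u n)) atTop)

open Classical in
/-- The kinetic energy `½ ∫₀¹ |γ̇_t|² dt`, equal to `+∞` if `γ` is not absolutely continuous. -/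
def kineticEnergy (γ : ℝ → X) : ℝ≥0∞ :=
  if ACOn γ 0 1 then 2⁻¹ * ∫⁻ t in Icc (0 : ℝ) 1, metricSpeed γ t ^ 2 else ⊤

/-- The halved Fisher information `½ ∫₀¹ |∂E|²(γ_t) dt`. -/
def fisherInformation (E : X → EReal) (γ : ℝ → X) : ℝ≥0∞ :=
  2⁻¹ * ∫⁻ t in Icc (0 : ℝ) 1, metricSlope E (γ t) ^ 2

/-- The action minimized in the Schrödinger problem at temperature `ε`. -/
def schrodingerAction (E : X → EReal) (ε : ℝ) (γ : ℝ → X) : ℝ≥0∞ :=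
  kineticEnergy γ + ENNReal.ofReal (ε ^ 2) * fisherInformation E γ

/-- Continuous curves on `[0, 1]` from `x` to `y`. -/
def curvesJoining (x y : X) : Set (ℝ → X) :=
  {γ | ContinuousOn γ (Icc (0 : ℝ) 1) ∧ γ 0 = x ∧ γ 1 = y}

/-- The Schrödinger problem between `x` and `y` is solvable: some competitor attains the infimum,
and the infimum is finite. -/
def SchrodingerSolvable (E : X → EReal) (ε : ℝ) (x y : X) : Prop :=
  ∃ γ ∈ curvesJoining x y, schrodingerAction E ε γ < ⊤ ∧
    IsMinOn (schrodingerAction E ε) (curvesJoining x y) γ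

end MetricSchrodinger

end

/-! Solvability reduces to finiteness of the action for one competitor, by the direct method: a
minimizing sequence is equi-Hölder, so compactness for `σ` and a diagonal argument give a pointwise
limit. Its kinetic energy is controlled by finite sums of squared increments, which see only
distances, and its Fisher information by Fatou's lemma (`schrodingerSolvable_of_action_lt_top`).

For (b) implies (a) the competitor comes from the flow. Two flows separate at most exponentially
(`IsIntegralFlow.dist_le`). Along one flow `u`, the squared right speed is at most `-(E ∘ u)'` at
differentiability points of `E ∘ u`, and the slope is at most the right speed. If `E (u 0)` is
finite, the total energy drop bounds both parts of the action on `[0, 1]`, so each endpoint is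
joined to its time-one image at finite cost (`IsIntegralFlow.finiteJoin`). Between these images runs
the time-one image of a Lipschitz reparametrization of the given curve: it is Lipschitz by
contraction and has bounded slope by regularization (`exists_metricSlope_bound`). Concatenating the
three pieces gives `finiteJoin_of_ACOn`.

For (a) implies (b) the slope bounds energy differences globally, up to a quadratic error and a
non-sharp constant (`Setting.exists_energy_le_of_metricSlope`). On each dyadic interval near an
endpoint one picks a time where the squared slope is at most its average. The energy increments
between consecutive such times are bounded by the mass of a finite measure on boundedly overlapping
intervals, so these energies stay bounded, and lower semicontinuity gives finite energy at the
endpoint (`energy_lt_top_of_finite_action`). -/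

namespace MetricSchrodinger

/-! ### Absolutely continuous curves: metric speed and increment bounds. -/

section AbsolutelyContinuousCurves

variable {X : Type*} [MetricSpace X]

/-- Cauchy–Schwarz against the constant function `1`. -/
lemma sq_lintegral_le_measure_mul {α : Type*} [MeasurableSpace α] {μ : Measure α} {f : α → ℝ≥0∞}
    (hf : AEMeasurable f μ) : (∫⁻ t, f t ∂μ) ^ 2 ≤ μ univ * ∫⁻ t, f t ^ 2 ∂μ := by
  have h := ENNReal.lintegral_mul_le_Lp_mul_Lq μ Real.HolderConjugate.two_two
    (aemeasurable_const (b := (1 : ℝ≥0∞))) hf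
  simp only [Pi.mul_apply, one_mul, ENNReal.one_rpow, lintegral_one] at h
  calc (∫⁻ t, f t ∂μ) ^ 2 ≤ (μ univ ^ (1 / (2 : ℝ)) * (∫⁻ t, f t ^ (2 : ℝ) ∂μ) ^ (1 / (2 : ℝ))) ^ 2 := by
        gcongr
    _ = μ univ * ∫⁻ t, f t ^ 2 ∂μ := by
        rw [mul_pow, ← ENNReal.rpow_natCast, ← ENNReal.rpow_natCast, ← ENNReal.rpow_mul,
          ← ENNReal.rpow_mul]
        norm_num

lemma dist_comp_absolutelyContinuous {γ : ℝ → X} {a b : ℝ}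
    (hγ : AbsolutelyContinuousOnInterval γ a b) (z : X) :
    AbsolutelyContinuousOnInterval (fun t => dist (γ t) z) a b := by
  refine squeeze_zero (fun _ => Finset.sum_nonneg fun _ _ => dist_nonneg) (fun I => ?_) hγ
  exact Finset.sum_le_sum fun i _ => by
    rw [Real.dist_eq]; exact abs_dist_sub_le _ _ _

lemma dist_le_abs_integral {γ : ℝ → X} {m : ℝ → ℝ} {a b : ℝ}
    (hd : ∀ s t : ℝ, a ≤ s → s ≤ t → t ≤ b → dist (γ s) (γ t) ≤ ∫ r in s..t, m r)
    (hm : IntegrableOn m (Icc a b)) {s t : ℝ} (hs : s ∈ Icc a b) (ht : t ∈ Icc a b) :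
    dist (γ s) (γ t) ≤ |(∫ r in a..s, m r) - ∫ r in a..t, m r| := by
  have hi : ∀ r ∈ Icc a b, IntervalIntegrable m volume a r := fun r hr =>
    (intervalIntegrable_iff_integrableOn_Icc_of_le hr.1).2
      (hm.mono_set (Icc_subset_Icc_right hr.2))
  rw [intervalIntegral.integral_interval_sub_left (hi s hs) (hi t ht)]
  rcases le_total s t with h | h
  · rw [intervalIntegral.integral_symm, abs_neg]
    exact (hd s t hs.1 h ht.2).trans (le_abs_self _)
  · rw [dist_comm]
    exact (hd t s ht.1 h hs.2).trans (le_abs_self _)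

lemma ACOn.absolutelyContinuous {γ : ℝ → X} {a b : ℝ} (hab : a ≤ b) (h : ACOn γ a b) :
    AbsolutelyContinuousOnInterval γ a b := by
  obtain ⟨m, hm, hd⟩ := h
  have hi : IntervalIntegrable m volume a b :=
    (intervalIntegrable_iff_integrableOn_Icc_of_le hab).2 hm
  have hM := hi.absolutelyContinuousOnInterval_intervalIntegral (c := a) left_mem_uIcc
  refine squeeze_zero' (.of_forall fun _ => Finset.sum_nonneg fun _ _ => dist_nonneg) ?_ hM
  have hmem : ∀ᶠ I in AbsolutelyContinuousOnInterval.totalLengthFilter ⊓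
      𝓟 (AbsolutelyContinuousOnInterval.disjWithin a b),
      I ∈ AbsolutelyContinuousOnInterval.disjWithin a b :=
    eventually_inf_principal.2 (.of_forall fun _ h => h)
  filter_upwards [hmem] with I hI
  refine Finset.sum_le_sum fun i hi => ?_
  have := hI.1 i hi
  rw [uIcc_of_le hab] at this
  rw [Real.dist_eq]
  exact dist_le_abs_integral hd hm this.1 this.2

lemma ACOn.continuousOn {γ : ℝ → X} {a b : ℝ} (hab : a ≤ b) (h : ACOn γ a b) :
    ContinuousOn γ (Icc a b) := by
  intro t ht
  have hc := (dist_comp_absolutelyContinuous (h.absolutelyContinuous hab) (γ t)).continuousOn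
  rw [uIcc_of_le hab] at hc
  have h0 := hc t ht
  rw [ContinuousWithinAt, dist_self] at h0
  exact tendsto_iff_dist_tendsto_zero.2 h0

/-- The metric speed is the smallest admissible density. -/
lemma metricSpeed_le_of_dist_le_integral {γ : ℝ → X} {m : ℝ → ℝ} {a b : ℝ} (hab : a ≤ b)
    (hm : IntegrableOn m (Icc a b))
    (hd : ∀ s t : ℝ, a ≤ s → s ≤ t → t ≤ b → dist (γ s) (γ t) ≤ ∫ r in s..t, m r) :
    ∀ᵐ t, t ∈ Ioo a b → metricSpeed γ t ≤ ENNReal.ofReal |m t| := by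
  have hi : IntervalIntegrable m volume a b :=
    (intervalIntegrable_iff_integrableOn_Icc_of_le hab).2 hm
  filter_upwards [hi.ae_hasDerivAt_integral] with t ht hmem
  rw [uIcc_of_le hab] at ht
  have hder := ht (Ioo_subset_Icc_self hmem) a (left_mem_Icc.2 hab)
  have hlim := (ENNReal.tendsto_ofReal (hasDerivAt_iff_tendsto_slope.1 hder).abs)
  rw [← hlim.limsup_eq]
  refine limsup_le_limsup ?_
  filter_upwards [self_mem_nhdsWithin,
    mem_nhdsWithin_of_mem_nhds (Ioo_mem_nhds hmem.1 hmem.2)] with s hne hs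
  have hst : 0 < |s - t| := abs_pos.2 (sub_ne_zero.2 hne)
  rw [edist_dist, edist_dist, Real.dist_eq, ← ENNReal.ofReal_div_of_pos hst, slope_def_field,
    abs_div]
  gcongr
  exact dist_le_abs_integral hd hm (Ioo_subset_Icc_self hs) (Ioo_subset_Icc_self hmem)

/-- The derivative is a full limit, so it can be read off along any set of times accumulating at
`t`. Hence bounds holding only frequently suffice; this matters later, when difference quotients are
controlled along a sequence of steps only. -/
lemma enorm_deriv_dist_le {γ : ℝ → X} {z : X} {t : ℝ} {g : ℝ≥0∞}
    (hφ : DifferentiableAt ℝ (fun s => dist (γ s) z) t)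
    (hg : ∀ C : ℝ, g < ENNReal.ofReal C → ∃ᶠ s in 𝓝[≠] t, dist (γ s) (γ t) ≤ C * |s - t|) :
    ‖deriv (fun s => dist (γ s) z) t‖ₑ ≤ g := by
  rw [Real.enorm_eq_ofReal_abs]
  by_contra! hlt
  obtain ⟨C, hC0, hgC, hC⟩ := ENNReal.lt_iff_exists_real_btwn.1 hlt
  have hC' := (ENNReal.ofReal_lt_ofReal_iff_of_nonneg hC0).1 hC
  have hlim := (hasDerivAt_iff_tendsto_slope.1 hφ.hasDerivAt).abs
  have hev := hlim.eventually (lt_mem_nhds hC')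
  obtain ⟨s, hs, ⟨hsC, hne⟩⟩ := ((hg C hgC).and_eventually (hev.and self_mem_nhdsWithin)).exists
  have hst : 0 < |s - t| := abs_pos.2 (sub_ne_zero.2 hne)
  rw [slope_def_field, abs_div, lt_div_iff₀ hst] at hsC
  exact absurd ((abs_dist_sub_le (γ s) (γ t) z).trans hs) (not_le.2 hsC)

/-- If the difference quotients of an absolutely continuous curve are frequently bounded by `g`
at almost every time, then increments are bounded by the integral of `g`, in `L¹` and in `L²` form. -/
lemma edist_le_lintegral_of_frequently {γ : ℝ → X} {a b : ℝ} (hab : a ≤ b)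
    (hγ : AbsolutelyContinuousOnInterval γ a b) {g : ℝ → ℝ≥0∞}
    (hg : ∀ᵐ t, t ∈ Ioo a b → ∀ C : ℝ, g t < ENNReal.ofReal C →
      ∃ᶠ s in 𝓝[≠] t, dist (γ s) (γ t) ≤ C * |s - t|) :
    edist (γ a) (γ b) ≤ ∫⁻ t in Ioc a b, g t ∧
    edist (γ a) (γ b) ^ 2 ≤ ENNReal.ofReal (b - a) * ∫⁻ t in Ioc a b, g t ^ 2 := by
  -- The total increment of this real function is exactly the distance between the endpoints, which
  -- reduces the claim to the fundamental theorem of calculus for real absolutely continuous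
  -- functions.
  set φ : ℝ → ℝ := fun t => dist (γ t) (γ a) with hφdef
  have hφ : AbsolutelyContinuousOnInterval φ a b := dist_comp_absolutelyContinuous hγ (γ a)
  have hle : ∀ᵐ t ∂volume.restrict (Ioc a b), ‖deriv φ t‖ₑ ≤ g t := by
    rw [ae_restrict_iff' measurableSet_Ioc]
    have hb : ∀ᵐ t : ℝ, t ≠ b := by simp [ae_iff, measure_singleton]
    filter_upwards [hg, hφ.ae_differentiableAt, hb] with t hgt hdt htb ht
    have ht' : t ∈ Ioo a b := ⟨ht.1, lt_of_le_of_ne ht.2 htb⟩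
    refine enorm_deriv_dist_le (hdt ?_) (hgt ht')
    rw [uIcc_of_le hab]
    exact Ioc_subset_Icc_self ht
  have hint : IntegrableOn (deriv φ) (Ioc a b) := by
    simpa [uIoc_of_le hab] using intervalIntegrable_iff.1 hφ.intervalIntegrable_deriv
  have hed : edist (γ a) (γ b) ≤ ∫⁻ t in Ioc a b, ‖deriv φ t‖ₑ := by
    have h1 := hφ.integral_deriv_eq_sub
    rw [intervalIntegral.integral_of_le hab] at h1
    have h2 : edist (γ a) (γ b) = ‖∫ t in Ioc a b, deriv φ t‖ₑ := by
      rw [h1]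
      simp [hφdef, edist_dist, Real.enorm_eq_ofReal_abs, dist_comm]
    rw [h2]
    exact enorm_integral_le_lintegral_enorm _
  refine ⟨hed.trans (lintegral_mono_ae hle), ?_⟩
  calc edist (γ a) (γ b) ^ 2 ≤ (∫⁻ t in Ioc a b, ‖deriv φ t‖ₑ) ^ 2 := by gcongr
    _ ≤ ENNReal.ofReal (b - a) * ∫⁻ t in Ioc a b, ‖deriv φ t‖ₑ ^ 2 := by
        simpa using sq_lintegral_le_measure_mul (μ := volume.restrict (Ioc a b))
          hint.1.aemeasurable.enorm
    _ ≤ _ := by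
        gcongr 1
        refine lintegral_mono_ae ?_
        filter_upwards [hle] with t ht
        gcongr

lemma eventually_dist_le_of_metricSpeed_lt {γ : ℝ → X} {t C : ℝ}
    (h : metricSpeed γ t < ENNReal.ofReal C) :
    ∀ᶠ s in 𝓝[≠] t, dist (γ s) (γ t) ≤ C * |s - t| := by
  filter_upwards [eventually_lt_of_limsup_lt h, self_mem_nhdsWithin] with s hs hne
  have hst : 0 < |s - t| := abs_pos.2 (sub_ne_zero.2 hne)
  rw [edist_dist, edist_dist, Real.dist_eq, ← ENNReal.ofReal_div_of_pos hst] at hs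
  have hC : 0 < C := by
    by_contra! hC
    rw [ENNReal.ofReal_of_nonpos hC] at hs
    exact not_lt_bot hs
  rw [ENNReal.ofReal_lt_ofReal_iff hC, div_lt_iff₀ hst] at hs
  exact hs.le

lemma ACOn.mono {γ : ℝ → X} {a b c d : ℝ} (h : ACOn γ a b) (hac : a ≤ c) (hdb : d ≤ b) :
    ACOn γ c d := by
  obtain ⟨m, hm, hd⟩ := h
  exact ⟨m, hm.mono_set (Icc_subset_Icc hac hdb), fun s t hs hst ht =>
    hd s t (hac.trans hs) hst (ht.trans hdb)⟩

lemma ACOn.edist_sq_le {γ : ℝ → X} {a b s t : ℝ} (h : ACOn γ a b) (has : a ≤ s) (hst : s ≤ t)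
    (htb : t ≤ b) :
    edist (γ s) (γ t) ^ 2 ≤ ENNReal.ofReal (t - s) * ∫⁻ r in Ioc s t, metricSpeed γ r ^ 2 :=
  (edist_le_lintegral_of_frequently hst ((h.mono has htb).absolutelyContinuous hst)
    (.of_forall fun _ _ _ hC => (eventually_dist_le_of_metricSpeed_lt hC).frequently)).2

end AbsolutelyContinuousCurves

/-! ### The evolution variational inequality in integrated form. -/

section IntegratedFlow

variable {X : Type*} [MetricSpace X] {E : X → EReal} {κ : ℝ} {u w : ℝ → X}

/-- The integrated form of the evolution variational inequality with parameter `-κ`, for a curve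
that is continuous up to time `0`. -/
structure IsIntegralFlow (E : X → EReal) (κ : ℝ) (u : ℝ → X) : Prop where
  cont : ContinuousOn u (Ici 0)
  quotient_bound : ∀ a b : ℝ, 0 < a → a < b → ∃ s ∈ Ioo a b, ∃ C : ℝ,
    ∀ᶠ h in 𝓝[>] (0 : ℝ), dist (u (s + h)) (u s) ≤ C * h
  finite_ae : ∀ᵐ t : ℝ, 0 < t → E (u t) < ⊤
  integrable : ∀ a b : ℝ, 0 < a → a ≤ b →
    IntervalIntegrable (fun t => (E (u t)).toReal) volume a b
  evi : ∀ y : X, E y < ⊤ → ∀ a b : ℝ, 0 < a → a ≤ b →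
    dist (u b) y ^ 2 - dist (u a) y ^ 2 ≤
      2 * ((b - a) * (E y).toReal - ∫ t in a..b, (E (u t)).toReal) +
        κ * ∫ t in a..b, dist (u t) y ^ 2

lemma Setting.coe_toReal (hE : Setting E) {x : X} (hx : E x < ⊤) :
    ((E x).toReal : EReal) = E x := EReal.coe_toReal hx.ne (hE.ne_bot x)

lemma Setting.le_toReal (hE : Setting E) {x : X} {c : ℝ} (hx : E x < ⊤) (h : (c : EReal) ≤ E x) :
    c ≤ (E x).toReal := by
  rw [← hE.coe_toReal hx] at h
  exact_mod_cast h

lemma Setting.exists_finite (hE : Setting E) (x : X) : ∃ y, E y < ⊤ := by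
  obtain ⟨y, hy⟩ := hE.dense_domain.nonempty_iff.2 ⟨x⟩
  exact ⟨y, hy⟩

lemma Setting.exists_lower_bound (hE : Setting E) {γ : ℝ → X} {a b : ℝ}
    (hγ : ContinuousOn γ (Icc a b)) : ∃ c : ℝ, ∀ t ∈ Icc a b, (c : EReal) ≤ E (γ t) := by
  obtain ⟨c, hc⟩ := hE.bounded_below _ (isCompact_Icc.image_of_continuousOn hγ).isBounded
  exact ⟨c, fun t ht => hc _ (mem_image_of_mem γ ht)⟩

lemma continuousOn_dist_const {γ : ℝ → X} {s : Set ℝ} (hγ : ContinuousOn γ s) (y : X) :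
    ContinuousOn (fun t => dist (γ t) y) s :=
  (continuous_id.dist continuous_const).comp_continuousOn hγ

lemma aemeasurable_comp_of_lowerSemicontinuous {β : Type*} [LinearOrder β]
    [TopologicalSpace β] [OrderTopology β] [SecondCountableTopology β] [MeasurableSpace β]
    [BorelSpace β] {f : X → β} (hf : LowerSemicontinuous f) {γ : ℝ → X} {a b : ℝ} (hab : a ≤ b)
    (hγ : ContinuousOn γ (Icc a b)) :
    AEMeasurable (fun t => f (γ t)) (volume.restrict (Icc a b)) := by
  have hc : Continuous (IccExtend hab (domRestrict (Icc a b) γ)) :=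
    (continuousOn_iff_continuous_domRestrict.1 hγ).Icc_extend'
  refine ⟨fun t => f (IccExtend hab (domRestrict (Icc a b) γ) t),
    (show LowerSemicontinuous _ from hf.comp hc).measurable, ?_⟩
  filter_upwards [ae_restrict_mem measurableSet_Icc] with t ht
  rw [IccExtend_of_mem _ _ ht, domRestrict_apply]

/-- An infinite `E p` would make the left side `⊤`. Replacing `lam` by the smaller `-κ` only weakens
the inequality, as squared distances are nonnegative; this allows `κ ≥ 0` throughout. -/
lemma real_inequality_of_evi (hE : Setting E) {lam D : ℝ} {p y : X} (hκ : -lam ≤ κ)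
    (hy : E y < ⊤)
    (h : ((1 / 2 * D + lam / 2 * dist p y ^ 2 : ℝ) : EReal) + E p ≤ E y) :
    E p < ⊤ ∧ D ≤ 2 * ((E y).toReal - (E p).toReal) + κ * dist p y ^ 2 := by
  have hp : E p < ⊤ := by
    by_contra hp
    rw [not_lt_top_iff.1 hp, EReal.coe_add_top] at h
    exact absurd hy (not_lt.2 h)
  refine ⟨hp, ?_⟩
  rw [← hE.coe_toReal hp, ← hE.coe_toReal hy] at h
  have h' : 1 / 2 * D + lam / 2 * dist p y ^ 2 + (E p).toReal ≤ (E y).toReal := by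
    exact_mod_cast h
  nlinarith [sq_nonneg (dist p y)]

/-- The speed is finite almost everywhere, hence somewhere in each interval. One such time is
enough, since contraction propagates the bound to all later times. -/
lemma ACLoc.exists_quotient_bound (h : ACLoc u) {a b : ℝ} (ha : 0 < a) (hab : a < b) :
    ∃ s ∈ Ioo a b, ∃ C : ℝ, ∀ᶠ h in 𝓝[>] (0 : ℝ), dist (u (s + h)) (u s) ≤ C * h := by
  obtain ⟨m, hm, hd⟩ := h a b ha hab
  have hae := metricSpeed_le_of_dist_le_integral hab.le hm hd
  have hvol : volume (Ioo a b) ≠ 0 := by simp [hab]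
  obtain ⟨s, hs, hspeed⟩ : ∃ s ∈ Ioo a b, metricSpeed u s ≤ ENNReal.ofReal |m s| := by
    by_contra! hcon
    refine hvol (measure_mono_null (fun t ht => ?_) hae)
    simpa using ⟨ht.1, ht.2, hcon t ht⟩ 
  refine ⟨s, hs, |m s| + 1, ?_⟩
  have hlt : metricSpeed u s < ENNReal.ofReal (|m s| + 1) := hspeed.trans_lt
    ((ENNReal.ofReal_lt_ofReal_iff (by positivity)).2 (by linarith))
  have hev := eventually_dist_le_of_metricSpeed_lt hlt
  have htend : Tendsto (fun h : ℝ => s + h) (𝓝[>] 0) (𝓝[≠] s) := by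
    refine tendsto_nhdsWithin_iff.2 ⟨?_, ?_⟩
    · have : Tendsto (fun h : ℝ => s + h) (𝓝 0) (𝓝 (s + 0)) :=
        tendsto_const_nhds.add tendsto_id
      rw [add_zero] at this
      exact this.mono_left nhdsWithin_le_nhds
    · filter_upwards [self_mem_nhdsWithin] with h hh
      simpa using (ne_of_gt hh)
  filter_upwards [htend.eventually hev, self_mem_nhdsWithin] with h hh hpos
  rwa [add_sub_cancel_left, abs_of_pos (mem_Ioi.1 hpos)] at hh

/-- The differential inequality holds off a null set depending on the test point `y`. Integration
removes this dependence, so that `y` may later move along another flow. -/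
lemma IsEVIFlow.isIntegralFlow (hE : Setting E) {lam : ℝ} (hκ : -lam ≤ κ)
    (hu : IsEVIFlow E lam u) (hc : ContinuousOn u (Ici 0)) : IsIntegralFlow E κ u := by
  have hkey : ∀ y : X, E y < ⊤ → ∀ᵐ t : ℝ, 0 < t → E (u t) < ⊤ ∧
      deriv (fun s => dist (u s) y ^ 2) t ≤
        2 * ((E y).toReal - (E (u t)).toReal) + κ * dist (u t) y ^ 2 := by
    intro y hy
    have h := hu.2 y
    rw [ae_restrict_iff' measurableSet_Ioi] at h
    filter_upwards [h] with t ht htpos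
    obtain ⟨D, hD, hle⟩ := ht htpos
    rw [hD.deriv]
    exact real_inequality_of_evi hE hκ hy hle
  have hcI : ∀ a b : ℝ, 0 < a → ContinuousOn u (Icc a b) := fun a b ha =>
    hc.mono fun t ht => ha.le.trans ht.1
  have hAC : ∀ (y : X) (a b : ℝ), 0 < a → a < b →
      AbsolutelyContinuousOnInterval (fun s => dist (u s) y ^ 2) a b := by
    intro y a b ha hab
    have := dist_comp_absolutelyContinuous ((hu.1 a b ha hab).absolutelyContinuous hab.le) y
    simpa [sq] using this.fun_mul this
  obtain ⟨y₀, hy₀⟩ := hE.exists_finite (u 0)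
  have hint : ∀ a b : ℝ, 0 < a → a < b →
      IntegrableOn (fun t => (E (u t)).toReal) (Icc a b) := by
    intro a b ha hab
    obtain ⟨c, hlow⟩ := hE.exists_lower_bound (hcI a b ha)
    have hmeas : AEMeasurable (fun t => (E (u t)).toReal) (volume.restrict (Icc a b)) :=
      measurable_ereal_toReal.comp_aemeasurable
        (aemeasurable_comp_of_lowerSemicontinuous hE.lsc hab.le (hcI a b ha))
    have hd : IntegrableOn (deriv fun s => dist (u s) y₀ ^ 2) (Icc a b) :=
      (intervalIntegrable_iff_integrableOn_Icc_of_le hab.le).1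
        (hAC y₀ a b ha hab).intervalIntegrable_deriv
    have hdist : IntegrableOn (fun t => dist (u t) y₀ ^ 2) (Icc a b) :=
      ((continuousOn_dist_const (hcI a b ha) _).pow 2).integrableOn_Icc
    -- The inequality with one fixed test point bounds the energy above by an integrable function;
    -- the lower bound is the constant `c`.
    have hup : IntegrableOn (fun t => (E y₀).toReal - 1 / 2 * deriv (fun s => dist (u s) y₀ ^ 2) t +
        κ / 2 * dist (u t) y₀ ^ 2) (Icc a b) :=
      ((integrableOn_const (by simp)).sub (hd.const_mul _)).add (hdist.const_mul _)
    have hlo : IntegrableOn (fun _ : ℝ => c) (Icc a b) := integrableOn_const (by simp)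
    refine integrable_of_le_of_le hmeas.aestronglyMeasurable ?_ ?_ hlo hup
    · filter_upwards [ae_restrict_of_ae (hkey y₀ hy₀), ae_restrict_mem measurableSet_Icc]
        with t ht hmem
      exact hE.le_toReal (ht (ha.trans_le hmem.1)).1 (hlow t hmem)
    · filter_upwards [ae_restrict_of_ae (hkey y₀ hy₀), ae_restrict_mem measurableSet_Icc]
        with t ht hmem
      linarith [(ht (ha.trans_le hmem.1)).2]
  have hint' : ∀ a b : ℝ, 0 < a → a ≤ b →
      IntervalIntegrable (fun t => (E (u t)).toReal) volume a b := by
    intro a b ha hab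
    rcases hab.eq_or_lt with rfl | hab
    · simp
    · exact (intervalIntegrable_iff_integrableOn_Icc_of_le hab.le).2 (hint a b ha hab)
  refine ⟨hc, fun a b ha hab => hu.1.exists_quotient_bound ha hab, ?_, hint', ?_⟩
  · filter_upwards [hkey y₀ hy₀] with t ht htpos using (ht htpos).1
  · intro y hy a b ha hab
    rcases hab.eq_or_lt with rfl | hlt
    · simp
    have hdist : IntervalIntegrable (fun t => dist (u t) y ^ 2) volume a b :=
      (intervalIntegrable_iff_integrableOn_Icc_of_le hab).2
        ((continuousOn_dist_const (hcI a b ha) _).pow 2).integrableOn_Icc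
    have h1 : IntervalIntegrable (fun t => 2 * ((E y).toReal - (E (u t)).toReal)) volume a b :=
      (intervalIntegrable_const.sub (hint' a b ha hab)).const_mul 2
    have h2 := hdist.const_mul κ
    calc dist (u b) y ^ 2 - dist (u a) y ^ 2
        = ∫ t in a..b, deriv (fun s => dist (u s) y ^ 2) t :=
          (hAC y a b ha hlt).integral_deriv_eq_sub.symm
      _ ≤ ∫ t in a..b, (2 * ((E y).toReal - (E (u t)).toReal) + κ * dist (u t) y ^ 2) := by
          refine intervalIntegral.integral_mono_ae_restrict hab
            (hAC y a b ha hlt).intervalIntegrable_deriv (h1.add h2) ?_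
          filter_upwards [ae_restrict_of_ae (hkey y hy), ae_restrict_mem measurableSet_Icc]
            with t ht hmem using (ht (ha.trans_le hmem.1)).2
      _ = _ := by
          rw [intervalIntegral.integral_add h1 h2, intervalIntegral.integral_const_mul,
            intervalIntegral.integral_const_mul,
            intervalIntegral.integral_sub intervalIntegrable_const (hint' a b ha hab),
            intervalIntegral.integral_const, smul_eq_mul]

/-- Every point is the starting point of a flow, with a common parameter. -/
lemma Setting.exists_isIntegralFlow (hE : Setting E) :
    ∃ κ : ℝ, 0 ≤ κ ∧ ∀ x : X, ∃ u : ℝ → X, IsIntegralFlow E κ u ∧ u 0 = x := by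
  obtain ⟨lam, hflow⟩ := hE.flow
  refine ⟨max (-lam) 0, le_max_right _ _, fun x => ?_⟩
  obtain ⟨γ, ⟨hac, hevi⟩, -, hγ⟩ := hflow x
  -- The given curve is constrained only at positive times; its value at `0` is replaced by its
  -- limit.
  set u : ℝ → X := fun t => if 0 < t then γ t else x with hu
  have hpos : ∀ t, 0 < t → u t = γ t := fun t ht => if_pos ht
  have hev : ∀ t, 0 < t → u =ᶠ[𝓝 t] γ := fun t ht => by
    filter_upwards [lt_mem_nhds ht] with s hs using hpos s hs
  have hu0 : u 0 = x := if_neg (lt_irrefl _)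
  have hacu : ACLoc u := by
    intro a b ha hab
    obtain ⟨m, hm, hd⟩ := hac a b ha hab
    refine ⟨m, hm, fun s t hs hst ht => ?_⟩
    rw [hpos s (ha.trans_le hs), hpos t (ha.trans_le (hs.trans hst))]
    exact hd s t hs hst ht
  refine ⟨u, IsEVIFlow.isIntegralFlow hE (le_max_left _ _) (lam := lam) ⟨hacu, fun y => ?_⟩ ?_, hu0⟩
  · filter_upwards [hevi y, ae_restrict_mem measurableSet_Ioi] with t ht htpos
    obtain ⟨D, hD, hle⟩ := ht
    refine ⟨D, hD.congr_of_eventuallyEq ?_, by rwa [hpos t htpos]⟩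
    filter_upwards [hev t htpos] with s hs
    rw [hs]
  · intro t ht
    rcases (mem_Ici.1 ht).eq_or_lt with rfl | htpos
    · rw [← Ioi_insert, continuousWithinAt_insert_self, ContinuousWithinAt, hu0]
      refine hγ.congr' ?_
      filter_upwards [self_mem_nhdsWithin] with s hs using (hpos s hs).symm
    · have hI := (hacu (t / 2) (t + 1) (by linarith) (by linarith)).continuousOn (by linarith)
      exact (hI.continuousAt (Icc_mem_nhds (by linarith) (by linarith))).continuousWithinAt

end IntegratedFlow

/-! ### Exponential contraction of two flows. -/

section Contraction

variable {X : Type*} [MetricSpace X] {E : X → EReal} {κ : ℝ} {u w : ℝ → X}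

/-- With `R` a primitive of `H`, the integral is `(R b - R (b - h)) - (R a - R (a - h))`. This
recovers increments of a merely continuous function from bounds on its finite differences, without
differentiating it. -/
lemma tendsto_average_increment {H : ℝ → ℝ} {c a b : ℝ} (hca : c < a) (hab : a ≤ b)
    (hH : ContinuousOn H (Icc c b)) :
    Tendsto (fun h => h⁻¹ * ∫ t in a..b, (H t - H (t - h))) (𝓝[>] 0) (𝓝 (H b - H a)) := by
  have hcb : c ≤ b := hca.le.trans hab
  set K : ℝ → ℝ := IccExtend hcb (domRestrict (Icc c b) H) with hKdef
  have hK : Continuous K := (continuousOn_iff_continuous_domRestrict.1 hH).Icc_extend'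
  have hKH : ∀ t ∈ Icc c b, K t = H t := fun t ht => by
    rw [hKdef, IccExtend_of_mem _ _ ht, domRestrict_apply]
  set R : ℝ → ℝ := fun x => ∫ t in (0 : ℝ)..x, K t with hR
  have hder : ∀ x, HasDerivAt R (K x) x := fun x =>
    intervalIntegral.integral_hasDerivAt_right (hK.intervalIntegrable _ _)
      (hK.stronglyMeasurableAtFilter _ _) hK.continuousAt
  have hlim : ∀ x, Tendsto (fun h => h⁻¹ * (R x - R (x - h))) (𝓝[>] 0) (𝓝 (K x)) := by
    intro x
    have h1 := hasDerivAt_iff_tendsto_slope_zero.1 (hder x)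
    have h2 : Tendsto (fun h : ℝ => -h) (𝓝[>] 0) (𝓝[≠] 0) := by
      refine tendsto_nhdsWithin_iff.2 ⟨?_, ?_⟩
      · have : Tendsto (fun h : ℝ => -h) (𝓝 0) (𝓝 (-0)) := tendsto_id.neg
        rw [neg_zero] at this
        exact this.mono_left nhdsWithin_le_nhds
      · filter_upwards [self_mem_nhdsWithin] with h hh
        simpa using (ne_of_gt hh)
    refine (h1.comp h2).congr fun h => ?_
    simp only [Function.comp, smul_eq_mul, inv_neg, ← sub_eq_add_neg]
    ring
  have hfin := (hlim b).sub (hlim a)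
  rw [hKH b ⟨hcb, le_rfl⟩, hKH a ⟨hca.le, hab⟩] at hfin
  refine hfin.congr' ?_
  filter_upwards [self_mem_nhdsWithin,
    mem_nhdsWithin_of_mem_nhds (gt_mem_nhds (sub_pos.2 hca))] with h hpos hlt
  have hpos' : 0 < h := hpos
  have hcongr : ∫ t in a..b, (H t - H (t - h)) = ∫ t in a..b, (K t - K (t - h)) := by
    refine intervalIntegral.integral_congr fun t ht => ?_
    rw [uIcc_of_le hab] at ht
    rw [hKH t ⟨by linarith [ht.1], ht.2⟩, hKH (t - h) ⟨by linarith [ht.1], by linarith [ht.2]⟩]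
  have hi : ∀ x y, IntervalIntegrable K volume x y := fun x y => hK.intervalIntegrable x y
  have hsub : ∀ x y, ∫ t in x..y, K t = R y - R x := fun x y => by
    rw [hR]
    exact (intervalIntegral.integral_interval_sub_left (hi 0 y) (hi 0 x)).symm
  have hKs : Continuous fun t => K (t - h) := hK.comp (continuous_sub_right h)
  rw [hcongr, intervalIntegral.integral_sub (hi a b) (hKs.intervalIntegrable a b),
    intervalIntegral.integral_comp_sub_right, hsub, hsub]
  ring

/-- Gronwall's inequality is applied to the right-hand side `Φ`, which is differentiable from the
right and satisfies `Φ' = k f ≤ k Φ`. -/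
lemma le_exp_mul_of_le_add_integral {f : ℝ → ℝ} {a b k : ℝ} (hab : a ≤ b) (hk : 0 ≤ k)
    (hf : ContinuousOn f (Icc a b))
    (h : ∀ t ∈ Icc a b, f t ≤ f a + k * ∫ r in a..t, f r) :
    f b ≤ Real.exp (k * (b - a)) * f a := by
  set Φ : ℝ → ℝ := fun t => f a + k * ∫ r in a..t, f r with hΦ
  have hi : IntervalIntegrable f volume a b :=
    (intervalIntegrable_iff_integrableOn_Icc_of_le hab).2 hf.integrableOn_Icc
  have hcont : ContinuousOn Φ (Icc a b) := by
    have := intervalIntegral.continuousOn_primitive_interval' hi left_mem_uIcc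
    rw [uIcc_of_le hab] at this
    exact continuousOn_const.add (continuousOn_const.mul this)
  have hder : ∀ t ∈ Ico a b, HasDerivWithinAt Φ (k * f t) (Ici t) t := by
    intro t ht
    have hti : IntervalIntegrable f volume a t :=
      hi.mono_set (by rw [uIcc_of_le hab, uIcc_of_le ht.1]; exact Icc_subset_Icc_right ht.2.le)
    have hft : ContinuousWithinAt f (Ici t) t :=
      (hf t (Ico_subset_Icc_self ht)).mono_of_mem_nhdsWithin
        (mem_of_superset (Icc_mem_nhdsGE ht.2) (Icc_subset_Icc_left ht.1))
    have hmeas : StronglyMeasurableAtFilter f (𝓝[>] t) := by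
      refine ⟨Ioc t b, Ioc_mem_nhdsGT ht.2, ?_⟩
      exact (hf.mono (fun s hs => ⟨ht.1.trans hs.1.le, hs.2⟩)).aestronglyMeasurable
        measurableSet_Ioc
    have := intervalIntegral.integral_hasDerivWithinAt_right hti (s := Ici t) (t := Ioi t)
      hmeas (hft.mono Ioi_subset_Ici_self)
    exact (this.const_mul k).const_add (f a)
  have hg := le_gronwallBound_of_liminf_deriv_right_le (f := Φ) (f' := fun t => k * f t)
    (δ := f a) (K := k) (ε := 0) hcont
    (fun t ht r hr => (hder t ht).liminf_right_slope_le hr) (by simp [hΦ])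
    (fun t ht => by
      have := mul_le_mul_of_nonneg_left (h t (Ico_subset_Icc_self ht)) hk
      simpa using this) b (right_mem_Icc.2 hab)
  rw [gronwallBound_ε0] at hg
  calc f b ≤ Φ b := h b (right_mem_Icc.2 hab)
    _ ≤ _ := by rw [mul_comm]; exact hg

/-- The increment of `d²(u, w)` over `[t - h, t]` is split at `d²(u_{t-h}, w_t)`: the inequality for
`u` is tested with `w t`, that for `w` with `u (t - h)`. After averaging in `t` and letting `h → 0`,
the energy terms cancel and only the `κ` terms remain. -/
lemma IsIntegralFlow.dist_sq_sub_le (hκ : 0 ≤ κ) (hu : IsIntegralFlow E κ u)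
    (hw : IsIntegralFlow E κ w) {a b : ℝ} (ha : 0 < a) (hab : a ≤ b) :
    dist (u b) (w b) ^ 2 ≤ dist (u a) (w a) ^ 2 +
      2 * κ * ∫ t in a..b, dist (u t) (w t) ^ 2 := by
  -- Leaves room below `a` for the shifted times `t - h` while staying away from `0`.
  set c := a / 2 with hc
  have hc0 : 0 < c := by positivity
  have hca : c < a := by simp only [hc]; linarith
  have hcb : c ≤ b := hca.le.trans hab
  set f : ℝ → ℝ := fun t => dist (u t) (w t) ^ 2 with hf
  set F : ℝ → ℝ := fun t => (E (u t)).toReal with hF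
  set G : ℝ → ℝ := fun t => (E (w t)).toReal with hG
  have hcu : ContinuousOn u (Icc c b) := hu.cont.mono fun t ht => hc0.le.trans ht.1
  have hcw : ContinuousOn w (Icc c b) := hw.cont.mono fun t ht => hc0.le.trans ht.1
  have hfc : ContinuousOn f (Icc c b) :=
    (continuous_dist.comp_continuousOn (hcu.prodMk hcw)).pow 2
  set P : ℝ → ℝ := fun t => ∫ r in c..t, F r with hP
  set Q : ℝ → ℝ := fun t => ∫ r in c..t, G r with hQ
  have hPc : ContinuousOn P (Icc c b) := by
    have := intervalIntegral.continuousOn_primitive_interval' (hu.integrable c b hc0 hcb) left_mem_uIcc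
    rwa [uIcc_of_le hcb] at this
  have hQc : ContinuousOn Q (Icc c b) := by
    have := intervalIntegral.continuousOn_primitive_interval' (hw.integrable c b hc0 hcb) left_mem_uIcc
    rwa [uIcc_of_le hcb] at this
  have hPsub : ∀ s t, c ≤ s → s ≤ t → ∫ r in s..t, F r = P t - P s := fun s t hs hst =>
    (intervalIntegral.integral_interval_sub_left (hu.integrable c t hc0 (hs.trans hst))
      (hu.integrable c s hc0 hs)).symm
  have hQsub : ∀ s t, c ≤ s → s ≤ t → ∫ r in s..t, G r = Q t - Q s := fun s t hs hst =>
    (intervalIntegral.integral_interval_sub_left (hw.integrable c t hc0 (hs.trans hst))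
      (hw.integrable c s hc0 hs)).symm
  -- Adding the primitives of the energies absorbs the integrals over `[t - h, t]` in both
  -- inequalities into the finite difference of `H`.
  set H : ℝ → ℝ := fun t => f t + 2 * P t + 2 * Q t with hH
  have hHc : ContinuousOn H (Icc c b) :=
    (hfc.add (continuousOn_const.mul hPc)).add (continuousOn_const.mul hQc)
  have hfi : IntervalIntegrable f volume a b :=
    (intervalIntegrable_iff_integrableOn_Icc_of_le hab).2
      (hfc.mono (Icc_subset_Icc_left hca.le)).integrableOn_Icc
  have hmain : ∀ δ > 0, f b - f a ≤ 2 * κ * (∫ t in a..b, f t) + 2 * κ * δ * (b - a) := by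
    intro δ hδ
    -- uniform continuity of `d²(u_p, w_q)`
    have huc : UniformContinuousOn (fun p : ℝ × ℝ => dist (u p.1) (w p.2) ^ 2)
        (Icc c b ×ˢ Icc c b) := by
      refine (isCompact_Icc.prod isCompact_Icc).uniformContinuousOn_of_continuous ?_
      have h1 : ContinuousOn (fun p : ℝ × ℝ => u p.1) (Icc c b ×ˢ Icc c b) :=
        hcu.comp continuousOn_fst fun p hp => hp.1
      have h2 : ContinuousOn (fun p : ℝ × ℝ => w p.2) (Icc c b ×ˢ Icc c b) :=
        hcw.comp continuousOn_snd fun p hp => hp.2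
      exact (continuous_dist.comp_continuousOn (h1.prodMk h2)).pow 2
    obtain ⟨η, hη, huc⟩ := Metric.uniformContinuousOn_iff.1 huc δ hδ
    have hlim := tendsto_average_increment hca hab hHc
    have hrhs : Tendsto (fun h => 2 * (Q b - Q a + (P (b - h) - P (a - h)) +
        κ * (∫ t in a..b, f t) + κ * δ * (b - a))) (𝓝[>] 0)
        (𝓝 (2 * (Q b - Q a + (P b - P a) + κ * (∫ t in a..b, f t) + κ * δ * (b - a)))) := by
      have hsh : ∀ x ∈ Ioc c b, Tendsto (fun h => P (x - h)) (𝓝[>] 0) (𝓝 (P x)) := by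
        intro x hx
        refine (hPc x (Ioc_subset_Icc_self hx)).tendsto.comp (tendsto_nhdsWithin_iff.2 ⟨?_, ?_⟩)
        · have : Tendsto (fun h : ℝ => x - h) (𝓝 0) (𝓝 (x - 0)) :=
            tendsto_const_nhds.sub tendsto_id
          rw [sub_zero] at this
          exact this.mono_left nhdsWithin_le_nhds
        · filter_upwards [self_mem_nhdsWithin,
            mem_nhdsWithin_of_mem_nhds (gt_mem_nhds (sub_pos.2 hx.1))] with h h1 h2
          have h1' : 0 < h := h1
          exact ⟨by linarith, by linarith [hx.2]⟩
      exact ((((hsh b ⟨hca.trans_le hab, le_rfl⟩).sub (hsh a ⟨hca, hab⟩)).const_add _).add_const _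
        |>.add_const _).const_mul 2
    have hle := le_of_tendsto_of_tendsto hlim hrhs ?_
    · simp only [hH] at hle
      linarith
    filter_upwards [self_mem_nhdsWithin,
      mem_nhdsWithin_of_mem_nhds (gt_mem_nhds (sub_pos.2 hca)),
      mem_nhdsWithin_of_mem_nhds (gt_mem_nhds hη)] with h hpos hhc hhη
    have hpos' : 0 < h := hpos
    have hfinu : ∀ᵐ t : ℝ, 0 < t - h → E (u (t - h)) < ⊤ :=
      (measurePreserving_sub_right volume h).quasiMeasurePreserving.ae hu.finite_ae
    have hpt : ∀ᵐ t : ℝ, t ∈ Icc a b →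
        H t - H (t - h) ≤ 2 * h * (G t + F (t - h) + κ * (f t + δ)) := by
      filter_upwards [hw.finite_ae, hfinu] with t htw htu ht
      have ht1 : c ≤ t - h := by linarith [ht.1]
      have ht0 : 0 < t - h := hc0.trans_le ht1
      have e1 := hu.evi (w t) (htw (by linarith)) (t - h) t ht0 (by linarith)
      have e2 := hw.evi (u (t - h)) (htu ht0) (t - h) t ht0 (by linarith)
      have hbound : ∀ p ∈ Icc (t - h) t, ∀ q ∈ Icc (t - h) t,
          dist (u p) (w q) ^ 2 ≤ f t + δ := by
        intro p hp q hq
        have hlt : dist (p, q) (t, t) < η := by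
          rw [Prod.dist_eq, max_lt_iff, Real.dist_eq, Real.dist_eq, abs_lt, abs_lt]
          exact ⟨⟨by linarith [hp.1], by linarith [hp.2]⟩, ⟨by linarith [hq.1], by linarith [hq.2]⟩⟩
        have := huc (p, q) ⟨⟨ht1.trans hp.1, hp.2.trans ht.2⟩, ⟨ht1.trans hq.1, hq.2.trans ht.2⟩⟩
          (t, t) ⟨⟨by linarith, ht.2⟩, ⟨by linarith, ht.2⟩⟩ hlt
        rw [Real.dist_eq] at this
        simp only [hf]
        linarith [(abs_lt.1 this).2]
      have hIle : ∀ k : ℝ → ℝ, ContinuousOn k (Icc (t - h) t) →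
          (∀ r ∈ Icc (t - h) t, k r ≤ f t + δ) → ∫ r in (t - h)..t, k r ≤ h * (f t + δ) := by
        intro k hk hkle
        have := intervalIntegral.integral_mono_on (by linarith)
          ((intervalIntegrable_iff_integrableOn_Icc_of_le (by linarith)).2 hk.integrableOn_Icc)
          (intervalIntegrable_const (μ := volume)) hkle
        simpa [mul_add] using this
      have hsub : Icc (t - h) t ⊆ Icc c b := Icc_subset_Icc ht1 ht.2
      have i1 := hIle (fun r => dist (u r) (w t) ^ 2)
        ((continuousOn_dist_const (hcu.mono hsub) _).pow 2)
        (fun r hr => hbound r hr t ⟨by linarith, le_rfl⟩)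
      have i2 := hIle (fun r => dist (w r) (u (t - h)) ^ 2)
        ((continuousOn_dist_const (hcw.mono hsub) _).pow 2)
        (fun r hr => by rw [dist_comm]; exact hbound _ ⟨le_rfl, by linarith⟩ r hr)
      rw [hPsub (t - h) t ht1 (by linarith)] at e1
      rw [hQsub (t - h) t ht1 (by linarith)] at e2
      have j1 := mul_le_mul_of_nonneg_left i1 hκ
      have j2 := mul_le_mul_of_nonneg_left i2 hκ
      rw [dist_comm (w t) (u (t - h)), dist_comm (w (t - h)) (u (t - h))] at e2
      simp only [hH, hf, hF, hG] at *
      nlinarith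
    have hGi := hw.integrable a b ha hab
    have hFi : IntervalIntegrable (fun t => F (t - h)) volume a b := by
      have := (hu.integrable (a - h) (b - h) (by linarith) (by linarith)).comp_sub_right h
      simpa using this
    have hHi : IntervalIntegrable H volume a b :=
      (intervalIntegrable_iff_integrableOn_Icc_of_le hab).2
        (hHc.mono (Icc_subset_Icc_left hca.le)).integrableOn_Icc
    have hHi' : IntervalIntegrable (fun t => H (t - h)) volume a b := by
      refine (intervalIntegrable_iff_integrableOn_Icc_of_le hab).2
        (ContinuousOn.integrableOn_Icc ?_)
      exact hHc.comp (by fun_prop) fun t ht =>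
        ⟨by linarith [ht.1], by linarith [ht.2]⟩
    have hint := intervalIntegral.integral_mono_ae_restrict hab (hHi.sub hHi')
      (((hGi.add hFi).add ((hfi.add (intervalIntegrable_const (c := δ))).const_mul κ)).const_mul
        (2 * h)) (by
        rw [EventuallyLE, ae_restrict_iff' measurableSet_Icc]
        exact hpt)
    rw [intervalIntegral.integral_const_mul, intervalIntegral.integral_add (hGi.add hFi)
      ((hfi.add intervalIntegrable_const).const_mul κ), intervalIntegral.integral_add hGi hFi,
      intervalIntegral.integral_const_mul, intervalIntegral.integral_add hfi
      intervalIntegrable_const, intervalIntegral.integral_const,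
      intervalIntegral.integral_comp_sub_right, hPsub (a - h) (b - h) (by linarith) (by linarith),
      hQsub a b hca.le hab, smul_eq_mul] at hint
    rw [inv_mul_le_iff₀ hpos']
    refine hint.trans (le_of_eq ?_)
    ring
  have := le_of_forall_pos_le_add (a := f b - f a) (b := 2 * κ * ∫ t in a..b, f t) (fun ε hε => by
    rcases (mul_nonneg hκ (sub_nonneg.2 hab)).eq_or_lt with h0 | h0
    · have := hmain 1 one_pos
      nlinarith
    · have := hmain (ε / (2 * (κ * (b - a)))) (by positivity)
      have h3 : 2 * κ * (ε / (2 * (κ * (b - a)))) * (b - a) = ε := by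
        have : κ * (b - a) ≠ 0 := h0.ne'
        have hk : κ ≠ 0 := left_ne_zero_of_mul this
        have hb : b - a ≠ 0 := right_ne_zero_of_mul this
        field_simp
      linarith)
  simp only [hf] at this ⊢
  linarith

/-- Flows contract distances up to an exponential factor. -/
lemma IsIntegralFlow.dist_le (hκ : 0 ≤ κ) (hu : IsIntegralFlow E κ u)
    (hw : IsIntegralFlow E κ w) {a b : ℝ} (ha : 0 ≤ a) (hab : a ≤ b) :
    dist (u b) (w b) ≤ Real.exp (κ * (b - a)) * dist (u a) (w a) := by
  have hpos : ∀ a, 0 < a → a ≤ b →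
      dist (u b) (w b) ≤ Real.exp (κ * (b - a)) * dist (u a) (w a) := by
    intro a ha hab
    have hcu : ContinuousOn u (Icc a b) := hu.cont.mono fun t ht => ha.le.trans ht.1
    have hcw : ContinuousOn w (Icc a b) := hw.cont.mono fun t ht => ha.le.trans ht.1
    have h := le_exp_mul_of_le_add_integral (f := fun t => dist (u t) (w t) ^ 2) hab
      (k := 2 * κ) (by positivity) ((continuous_dist.comp_continuousOn (hcu.prodMk hcw)).pow 2)
      (fun t ht => hu.dist_sq_sub_le hκ hw ha ht.1)
    refine le_of_sq_le_sq (h.trans (le_of_eq ?_)) (by positivity)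
    rw [mul_pow, ← Real.exp_nat_mul]
    push_cast
    ring_nf
  rcases ha.eq_or_lt with rfl | ha
  · rcases hab.eq_or_lt with rfl | hb
    · simp
    have hc : ContinuousWithinAt (fun a => Real.exp (κ * (b - a)) * dist (u a) (w a)) (Ici 0) 0 := by
      refine ContinuousWithinAt.mul (by fun_prop) ?_
      exact continuous_dist.continuousAt.comp_continuousWithinAt
        ((hu.cont 0 self_mem_Ici).prodMk (hw.cont 0 self_mem_Ici))
    refine ge_of_tendsto (hc.mono Ioi_subset_Ici_self).tendsto ?_
    filter_upwards [Ioc_mem_nhdsGT hb] with s hs using hpos s hs.1 hs.2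
  · exact hpos a ha hab

end Contraction

/-! ### Slope, initial speed of the flow, and global energy bounds. -/

section FlowSlope

variable {X : Type*} [MetricSpace X] {E : X → EReal} {κ : ℝ} {u w : ℝ → X}

lemma IsIntegralFlow.shift (hu : IsIntegralFlow E κ u) {τ : ℝ} (hτ : 0 ≤ τ) :
    IsIntegralFlow E κ (fun t => u (t + τ)) := by
  refine ⟨hu.cont.comp (by fun_prop) fun t ht => add_nonneg ht hτ, ?_, ?_, ?_, ?_⟩
  · intro a b ha hab
    obtain ⟨s, hs, C, hC⟩ := hu.quotient_bound (a + τ) (b + τ) (by linarith) (by linarith)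
    refine ⟨s - τ, ⟨by linarith [hs.1], by linarith [hs.2]⟩, C, ?_⟩
    filter_upwards [hC] with h hh
    rwa [show s - τ + h + τ = s + h by ring, sub_add_cancel]
  · filter_upwards [(measurePreserving_add_right volume τ).quasiMeasurePreserving.ae hu.finite_ae]
      with t ht htpos using ht (by linarith)
  · intro a b ha hab
    have := (hu.integrable (a + τ) (b + τ) (by linarith) (by linarith)).comp_add_right τ
    simpa using this
  · intro y hy a b ha hab
    have h := hu.evi y hy (a + τ) (b + τ) (by linarith) (by linarith)
    rw [intervalIntegral.integral_comp_add_right (fun t => (E (u t)).toReal),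
      intervalIntegral.integral_comp_add_right (fun t => dist (u t) y ^ 2)]
    rwa [add_sub_add_right_eq_sub] at h

/-- The evolution variational inequality from time `0`, with constant bounds on the energy and the
distance. -/
lemma IsIntegralFlow.dist_sq_sub_le_of_bounds (hE : Setting E) (hκ : 0 ≤ κ)
    (hu : IsIntegralFlow E κ u) {y : X}
    (hy : E y < ⊤) {t c M : ℝ} (ht : 0 < t) (hc : ∀ r ∈ Ioc 0 t, (c : EReal) ≤ E (u r))
    (hM : ∀ r ∈ Ioc 0 t, dist (u r) y ^ 2 ≤ M) :
    dist (u t) y ^ 2 - dist (u 0) y ^ 2 ≤ t * (2 * ((E y).toReal - c) + κ * M) := by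
  have hlim : Tendsto (fun a => (t - a) * (2 * ((E y).toReal - c) + κ * M) + dist (u a) y ^ 2)
      (𝓝[>] 0) (𝓝 ((t - 0) * (2 * ((E y).toReal - c) + κ * M) + dist (u 0) y ^ 2)) := by
    have hd : ContinuousWithinAt (fun a => dist (u a) y ^ 2) (Ioi 0) 0 :=
      ((continuousOn_dist_const hu.cont y).pow 2 0 self_mem_Ici).mono Ioi_subset_Ici_self
    refine Tendsto.add (Tendsto.mul_const _ ?_) hd.tendsto
    exact (tendsto_const_nhds.sub tendsto_id).mono_left nhdsWithin_le_nhds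
  have hge := ge_of_tendsto (b := dist (u t) y ^ 2) hlim ?_
  · rw [sub_zero] at hge
    linarith
  filter_upwards [Ioc_mem_nhdsGT ht] with a ha
  have hevi := hu.evi y hy a t ha.1 ha.2
  have h1 : (t - a) * c ≤ ∫ r in a..t, (E (u r)).toReal := by
    have := intervalIntegral.integral_mono_ae_restrict ha.2
      (intervalIntegrable_const (c := c)) (hu.integrable a t ha.1 ha.2) (by
        filter_upwards [ae_restrict_of_ae hu.finite_ae, ae_restrict_mem measurableSet_Icc]
          with r hr hmem
        have hr0 := ha.1.trans_le hmem.1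
        exact hE.le_toReal (hr hr0) (hc r ⟨hr0, hmem.2⟩))
    simpa using this
  have h2 : ∫ r in a..t, dist (u r) y ^ 2 ≤ (t - a) * M := by
    have := intervalIntegral.integral_mono_on ha.2
      ((intervalIntegrable_iff_integrableOn_Icc_of_le ha.2).2
        ((continuousOn_dist_const (hu.cont.mono fun r hr => ha.1.le.trans hr.1) y).pow
          2).integrableOn_Icc)
      (intervalIntegrable_const (c := M) (μ := volume))
      (fun r hr => hM r ⟨ha.1.trans_le hr.1, hr.2⟩)
    simpa using this
  have h3 := mul_le_mul_of_nonneg_left h2 hκ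
  nlinarith

lemma IsIntegralFlow.tendsto_zero (hu : IsIntegralFlow E κ u) :
    Tendsto u (𝓝[>] 0) (𝓝 (u 0)) :=
  ((hu.cont 0 self_mem_Ici).mono Ioi_subset_Ici_self).tendsto

lemma exists_pos_forall_Ioc_of_eventually {p : ℝ → Prop} (h : ∀ᶠ t in 𝓝[>] (0 : ℝ), p t) :
    ∃ T > 0, ∀ t ∈ Ioc 0 T, p t := by
  obtain ⟨T, hT, h⟩ := mem_nhdsGT_iff_exists_Ioc_subset.1 h
  exact ⟨T, hT, fun t ht => h ht⟩

/-- The speed bound gives `d²(u_t, y) - d²(u_0, y) ≥ -2 q t d(u_0, y)`. Comparing with the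
variational inequality on `[0, t]`, dividing by `t` and using lower semicontinuity at `u 0` yields
the bound. Finiteness of `E (u 0)` is a conclusion here, so arbitrary reals `c` below `E (u 0)` are
used. -/
lemma IsIntegralFlow.energy_le_of_quotient (hE : Setting E) (hκ : 0 ≤ κ)
    (hu : IsIntegralFlow E κ u) {q : ℝ}
    (hq : ∀ᶠ h in 𝓝[>] (0 : ℝ), dist (u h) (u 0) ≤ q * h) {y : X} (hy : E y < ⊤) :
    E (u 0) ≤ (((E y).toReal + q * dist (u 0) y + κ / 2 * dist (u 0) y ^ 2 : ℝ) : EReal) := by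
  refine EReal.ge_of_forall_gt_iff_ge.1 fun c hc => ?_
  rw [EReal.coe_le_coe_iff]
  set d := dist (u 0) y with hd
  have hkey : ∀ δ > 0, c ≤ (E y).toReal + q * d + κ / 2 * (d ^ 2 + δ) := by
    intro δ hδ
    have h1 : ∀ᶠ h in 𝓝[>] (0 : ℝ), (c : EReal) < E (u h) :=
      hu.tendsto_zero.eventually (hE.lsc (u 0) c hc)
    have h2 : ∀ᶠ h in 𝓝[>] (0 : ℝ), dist (u h) y ^ 2 < d ^ 2 + δ := by
      have : Tendsto (fun h => dist (u h) y ^ 2) (𝓝[>] 0) (𝓝 (d ^ 2)) :=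
        (hu.tendsto_zero.dist tendsto_const_nhds).pow 2
      exact this.eventually (gt_mem_nhds (by linarith))
    obtain ⟨t, ht, h⟩ := exists_pos_forall_Ioc_of_eventually (h1.and (h2.and hq))
    have hb := hu.dist_sq_sub_le_of_bounds hE hκ hy ht (fun r hr => (h r hr).1.le)
      (fun r hr => (h r hr).2.1.le)
    have hqt := (h t ⟨ht, le_rfl⟩).2.2
    have habs := abs_le.1 (abs_dist_sub_le (u t) (u 0) y)
    have hd0 : 0 ≤ d := dist_nonneg
    have hlow : -(2 * d * (q * t)) ≤ dist (u t) y ^ 2 - d ^ 2 := by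
      have h3 : d * dist (u t) (u 0) ≤ d * (q * t) := mul_le_mul_of_nonneg_left hqt hd0
      nlinarith [habs.1, habs.2, sq_nonneg (dist (u t) y - d)]
    have h4 : t * (-(2 * d * q)) ≤ t * (2 * ((E y).toReal - c) + κ * (d ^ 2 + δ)) := by
      linarith
    have h5 := le_of_mul_le_mul_left h4 ht
    linarith
  have hlim : Tendsto (fun δ => (E y).toReal + q * d + κ / 2 * (d ^ 2 + δ)) (𝓝[>] 0)
      (𝓝 ((E y).toReal + q * d + κ / 2 * (d ^ 2 + 0))) := by
    have : Continuous fun δ => (E y).toReal + q * d + κ / 2 * (d ^ 2 + δ) := by fun_prop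
    exact this.continuousAt.tendsto.mono_left nhdsWithin_le_nhds
  rw [add_zero] at hlim
  refine ge_of_tendsto hlim ?_
  filter_upwards [self_mem_nhdsWithin] with δ hδ using hkey δ hδ

/-- After division by the distance the quadratic error tends to `0`. Points of infinite energy
contribute quotient `0`. -/
lemma metricSlope_le_of_energy_le (hE : Setting E) {x : X} (hx : E x < ⊤) {q : ℝ} (hq : 0 ≤ q)
    (h : ∀ y, E y < ⊤ →
      E x ≤ (((E y).toReal + q * dist x y + κ / 2 * dist x y ^ 2 : ℝ) : EReal)) :
    metricSlope E x ≤ ENNReal.ofReal q := by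
  have hmem : x ∈ domain E := hx
  rw [metricSlope, if_pos hmem]
  have hkey : ∀ p > q, limsup (fun y : X => (E x - E y).toENNReal / edist x y) (𝓝[≠] x) ≤
      ENNReal.ofReal p := by
    intro p hp
    refine limsup_le_of_le (h := ?_)
    have hev : ∀ᶠ y in 𝓝 x, q + κ / 2 * dist x y < p := by
      have hc : Continuous fun y => q + κ / 2 * dist x y := by fun_prop
      have : Tendsto (fun y => q + κ / 2 * dist x y) (𝓝 x) (𝓝 (q + κ / 2 * dist x x)) :=
        hc.continuousAt
      exact this.eventually (gt_mem_nhds (by simpa using hp))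
    filter_upwards [mem_nhdsWithin_of_mem_nhds hev, self_mem_nhdsWithin] with y hy hne
    have hd : 0 < dist x y := dist_pos.2 (Ne.symm hne)
    rw [edist_dist, ENNReal.div_le_iff_le_mul (Or.inl (by simpa using Ne.symm hne)) (Or.inl ENNReal.ofReal_ne_top),
      ← ENNReal.ofReal_mul (hq.trans hp.le)]
    by_cases hyt : E y < ⊤
    · have hr := h y hyt
      rw [← hE.coe_toReal hx, EReal.coe_le_coe_iff] at hr
      rw [← hE.coe_toReal hx, ← hE.coe_toReal hyt, ← EReal.coe_sub, EReal.toENNReal_of_ne_top (EReal.coe_ne_top _),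
        EReal.toReal_coe]
      refine ENNReal.ofReal_le_ofReal ?_
      nlinarith
    · rw [not_lt_top_iff.1 hyt, EReal.sub_top]
      simp
  have hlim : Tendsto (fun p => ENNReal.ofReal p) (𝓝[>] q) (𝓝 (ENNReal.ofReal q)) :=
    (ENNReal.continuous_ofReal.tendsto q).mono_left nhdsWithin_le_nhds
  refine ge_of_tendsto hlim ?_
  filter_upwards [self_mem_nhdsWithin] with p hp using hkey p hp

lemma lt_top_of_metricSlope_lt_top {x : X} (h : metricSlope E x < ⊤) : E x < ⊤ := by
  by_contra hx
  rw [metricSlope, if_neg (show x ∉ domain E from hx)] at h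
  exact lt_irrefl _ h

lemma eventually_energy_le_of_metricSlope (hE : Setting E) {x : X} (h : metricSlope E x < ⊤) :
    ∀ᶠ y in 𝓝 x, (((E x).toReal - ((metricSlope E x).toReal + 1) * dist x y : ℝ) : EReal) ≤ E y := by
  have hx := lt_top_of_metricSlope_lt_top h
  set S := (metricSlope E x).toReal with hS
  have hlt : metricSlope E x < ENNReal.ofReal (S + 1) := by
    rw [ENNReal.lt_ofReal_iff_toReal_lt h.ne]
    linarith
  have hlt' := hlt
  rw [metricSlope, if_pos (show x ∈ domain E from hx)] at hlt'
  have hev := eventually_lt_of_limsup_lt hlt'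
  rw [eventually_nhdsWithin_iff] at hev
  filter_upwards [hev] with y hy
  by_cases hxy : y = x
  · subst hxy
    rw [dist_self, mul_zero, sub_zero, hE.coe_toReal hx]
  have hd : 0 < dist x y := dist_pos.2 (Ne.symm hxy)
  by_cases hyt : E y < ⊤
  · have h1 := (hy hxy).le
    have hS0 : 0 ≤ S + 1 := by positivity
    rw [edist_dist, ENNReal.div_le_iff_le_mul (Or.inl (by simpa using Ne.symm hxy))
      (Or.inl ENNReal.ofReal_ne_top), ← ENNReal.ofReal_mul hS0,
      ← hE.coe_toReal hx, ← hE.coe_toReal hyt, ← EReal.coe_sub,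
      EReal.toENNReal_of_ne_top (EReal.coe_ne_top _), EReal.toReal_coe,
      ENNReal.ofReal_le_ofReal_iff (by positivity)] at h1
    rw [← hE.coe_toReal hyt, EReal.coe_le_coe_iff]
    linarith
  · rw [not_lt_top_iff.1 hyt]
    exact le_top

/-- A flow leaves a point of finite slope at bounded speed. -/
lemma IsIntegralFlow.eventually_dist_le_of_metricSlope (hE : Setting E) (hκ : 0 ≤ κ)
    (hu : IsIntegralFlow E κ u) (h : metricSlope E (u 0) < ⊤) :
    ∀ᶠ t in 𝓝[>] (0 : ℝ),
      dist (u t) (u 0) ≤ 4 * ((metricSlope E (u 0)).toReal + 1) * t := by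
  set S := (metricSlope E (u 0)).toReal + 1 with hS
  have hS0 : 0 < S := by positivity
  have hx := lt_top_of_metricSlope_lt_top h
  have hev := hu.tendsto_zero.eventually (eventually_energy_le_of_metricSlope hE h)
  have hsmall : ∀ᶠ t in 𝓝[>] (0 : ℝ), κ * t < 1 / 2 := by
    have hc : Tendsto (fun t => κ * t) (𝓝 0) (𝓝 (κ * 0)) := tendsto_const_nhds.mul tendsto_id
    rw [mul_zero] at hc
    exact (hc.mono_left nhdsWithin_le_nhds).eventually (gt_mem_nhds (by norm_num))
  obtain ⟨T, hT, hb⟩ := exists_pos_forall_Ioc_of_eventually (hev.and hsmall)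
  filter_upwards [Ioc_mem_nhdsGT hT] with t ht
  -- Let `M` be the largest distance from `u 0` on `[0, t]`, attained at `s`. Testing with `u 0` on
  -- `[0, s]`, where the energy is at least `E (u 0) - S M`, gives `M² ≤ t (2 S M + κ M²)`. Since `κ
  -- t < 1 / 2`, this yields `M ≤ 4 S t`; hence the constant `4`.
  obtain ⟨s, hs, hmax⟩ := isCompact_Icc.exists_isMaxOn (nonempty_Icc.2 ht.1.le)
    (continuousOn_dist_const (hu.cont.mono fun r (hr : r ∈ Icc 0 t) => hr.1) (u 0))
  have hmax' : ∀ r ∈ Icc 0 t, dist (u r) (u 0) ≤ dist (u s) (u 0) := fun r hr => hmax hr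
  set M := dist (u s) (u 0) with hM
  have hM0 : 0 ≤ M := dist_nonneg
  refine (hmax' t ⟨ht.1.le, le_rfl⟩).trans ?_
  rcases hs.1.eq_or_lt with h0 | h0
  · rw [hM, ← h0, dist_self]
    have := ht.1
    positivity
  have hd := hu.dist_sq_sub_le_of_bounds hE hκ hx h0
    (c := (E (u 0)).toReal - S * M) (M := M ^ 2) (fun r hr => ?_) (fun r hr => ?_)
  · rw [dist_self, ← hM] at hd
    have hk := (hb t ht).2
    by_contra! hlt
    have hMpos : 0 < M := lt_of_le_of_lt (by have := ht.1; positivity) hlt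
    have h1 : s * (2 * ((E (u 0)).toReal - ((E (u 0)).toReal - S * M)) + κ * M ^ 2) ≤
        t * (2 * S * M + κ * M ^ 2) := by
      have : 0 ≤ 2 * S * M + κ * M ^ 2 := by positivity
      nlinarith [mul_le_mul_of_nonneg_right hs.2 this]
    have h2 : M * M ≤ M * (t * (2 * S) + κ * t * M) := by nlinarith
    have h3 := le_of_mul_le_mul_left h2 hMpos
    nlinarith
  · have hr' : r ∈ Ioc 0 T := ⟨hr.1, hr.2.trans (hs.2.trans ht.2)⟩
    refine le_trans (EReal.coe_le_coe_iff.2 ?_) (hb r hr').1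
    have := hmax' r ⟨hr.1.le, hr.2.trans hs.2⟩
    rw [dist_comm] at this
    nlinarith
  · have := hmax' r ⟨hr.1.le, hr.2.trans hs.2⟩
    gcongr

/-- The slope controls energy differences globally. -/
lemma Setting.exists_energy_le_of_metricSlope (hE : Setting E) :
    ∃ κ : ℝ, 0 ≤ κ ∧ ∀ x y : X, metricSlope E x < ⊤ → E y < ⊤ →
      (E x).toReal ≤ (E y).toReal + 4 * ((metricSlope E x).toReal + 1) * dist x y +
        κ / 2 * dist x y ^ 2 := by
  obtain ⟨κ, hκ, hflow⟩ := hE.exists_isIntegralFlow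
  refine ⟨κ, hκ, fun x y hx hy => ?_⟩
  obtain ⟨u, hu, rfl⟩ := hflow x
  have h := hu.energy_le_of_quotient hE hκ (hu.eventually_dist_le_of_metricSlope hE hκ hx) hy
  rwa [← hE.coe_toReal (lt_top_of_metricSlope_lt_top hx), EReal.coe_le_coe_iff] at h

end FlowSlope

/-! ### Regularization: Lipschitz bounds and energy dissipation at positive times. -/

section FlowRegularity

variable {X : Type*} [MetricSpace X] {E : X → EReal} {κ : ℝ} {u w : ℝ → X}

/-- Difference quotients at later times are controlled by those at earlier times. -/
lemma IsIntegralFlow.dist_add_le (hκ : 0 ≤ κ) (hu : IsIntegralFlow E κ u) {s t h : ℝ}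
    (hs : 0 ≤ s) (hst : s ≤ t) (hh : 0 ≤ h) :
    dist (u (t + h)) (u t) ≤ Real.exp (κ * (t - s)) * dist (u (s + h)) (u s) :=
  (hu.shift hh).dist_le hκ hu hs hst

/-- A time before `a` with bounded forward quotient exists. Contraction between `u` and its own time
shifts carries this bound to every later time, and a mean value inequality for one-sided derivatives
integrates it. -/
lemma IsIntegralFlow.exists_lipschitz (hκ : 0 ≤ κ) (hu : IsIntegralFlow E κ u) {a b : ℝ}
    (ha : 0 < a) : ∃ C : ℝ, 0 ≤ C ∧
      ∀ s ∈ Icc a b, ∀ t ∈ Icc a b, dist (u s) (u t) ≤ C * |s - t| := by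
  obtain ⟨s₀, hs₀, C₀, hC₀⟩ := hu.quotient_bound (a / 2) a (by linarith) (by linarith)
  have hs₀pos : 0 < s₀ := by linarith [hs₀.1]
  have hC₀nn : 0 ≤ C₀ := by
    obtain ⟨h, hh, hpos⟩ := (hC₀.and self_mem_nhdsWithin).exists
    have hpos' : 0 < h := hpos
    by_contra! hneg
    nlinarith [dist_nonneg (x := u (s₀ + h)) (y := u s₀)]
  set C := Real.exp (κ * b) * C₀ with hC
  have hCnn : 0 ≤ C := by positivity
  have hloc : ∀ t ∈ Icc a b, ∀ᶠ h in 𝓝[>] (0 : ℝ), dist (u (t + h)) (u t) ≤ C * h := by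
    intro t ht
    filter_upwards [hC₀, self_mem_nhdsWithin] with h hh hpos
    have hpos' : 0 < h := hpos
    refine (hu.dist_add_le hκ hs₀pos.le (hs₀.2.le.trans ht.1) hpos'.le).trans ?_
    rw [hC, mul_assoc]
    refine mul_le_mul (Real.exp_le_exp.2 ?_) hh dist_nonneg (Real.exp_pos _).le
    exact mul_le_mul_of_nonneg_left (by linarith [ht.2]) hκ
  have hord : ∀ s ∈ Icc a b, ∀ t ∈ Icc s b, dist (u t) (u s) ≤ C * (t - s) := by
    intro s hs
    refine image_le_of_liminf_slope_right_le_deriv_boundary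
      (continuousOn_dist_const (hu.cont.mono fun r hr => ha.le.trans (hs.1.trans hr.1)) (u s))
      (by simp) (by fun_prop) (B' := fun _ => C) (fun r _ => ?_) (fun r hr c hc => ?_)
    · have := (((hasDerivAt_id r).sub_const s).const_mul C).hasDerivWithinAt (s := Ici r)
      simpa using this
    · have htend : Tendsto (fun z => z - r) (𝓝[>] r) (𝓝[>] 0) := by
        refine tendsto_nhdsWithin_iff.2 ⟨?_, ?_⟩
        · have : Tendsto (fun z => z - r) (𝓝 r) (𝓝 (r - r)) := tendsto_id.sub tendsto_const_nhds
          rw [sub_self] at this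
          exact this.mono_left nhdsWithin_le_nhds
        · filter_upwards [self_mem_nhdsWithin] with z hz
          simpa using hz
      refine Eventually.frequently ?_
      filter_upwards [htend.eventually (hloc r ⟨hs.1.trans hr.1, hr.2.le⟩), self_mem_nhdsWithin]
        with z hz hzr
      have hzr' : 0 < z - r := sub_pos.2 hzr
      rw [add_sub_cancel] at hz
      rw [slope_def_field, div_lt_iff₀ hzr']
      have := (abs_le.1 (abs_dist_sub_le (u z) (u r) (u s))).2
      nlinarith
  refine ⟨C, hCnn, fun s hs t ht => ?_⟩
  rcases le_total s t with h | h
  · rw [dist_comm, abs_sub_comm, abs_of_nonneg (sub_nonneg.2 h)]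
    exact hord s hs t ⟨h, ht.2⟩
  · rw [abs_of_nonneg (sub_nonneg.2 h)]
    exact hord t ht s ⟨h, hs.2⟩

lemma IsIntegralFlow.energy_le_at (hE : Setting E) (hκ : 0 ≤ κ) (hu : IsIntegralFlow E κ u)
    {t q : ℝ} (ht : 0 ≤ t) (hq : ∀ᶠ h in 𝓝[>] (0 : ℝ), dist (u (t + h)) (u t) ≤ q * h) {y : X}
    (hy : E y < ⊤) :
    E (u t) ≤ (((E y).toReal + q * dist (u t) y + κ / 2 * dist (u t) y ^ 2 : ℝ) : EReal) := by
  have h := (hu.shift ht).energy_le_of_quotient hE hκ (q := q) (y := y)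
    (by simpa [add_comm] using hq) hy
  simpa using h

lemma eventually_quotient_of_lipschitz {a b C t : ℝ}
    (hC : ∀ s ∈ Icc a b, ∀ t ∈ Icc a b, dist (u s) (u t) ≤ C * |s - t|) (ht : t ∈ Ico a b) :
    ∀ᶠ h in 𝓝[>] (0 : ℝ), dist (u (t + h)) (u t) ≤ C * h := by
  filter_upwards [Ioc_mem_nhdsGT (sub_pos.2 ht.2)] with h hh
  have := hC (t + h) ⟨by linarith [ht.1, hh.1], by linarith [hh.2]⟩ t (Ico_subset_Icc_self ht)
  rwa [add_sub_cancel_left, abs_of_pos hh.1] at this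

/-- The bounded forward quotient at `t` bounds the energy there, which upgrades almost every
positive time to every positive time, whatever the energy of the initial point. -/
lemma IsIntegralFlow.energy_lt_top (hE : Setting E) (hκ : 0 ≤ κ) (hu : IsIntegralFlow E κ u)
    {t : ℝ} (ht : 0 < t) : E (u t) < ⊤ := by
  obtain ⟨C, -, hC⟩ := hu.exists_lipschitz hκ (b := t + 1) ht
  obtain ⟨y, hy⟩ := hE.exists_finite (u 0)
  exact (hu.energy_le_at hE hκ ht.le
    (eventually_quotient_of_lipschitz hC ⟨le_rfl, by linarith⟩) hy).trans_lt (EReal.coe_lt_top _)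

lemma IsIntegralFlow.exists_lipschitz_energy (hE : Setting E) (hκ : 0 ≤ κ)
    (hu : IsIntegralFlow E κ u) {a b : ℝ} (ha : 0 < a) :
    ∃ L : NNReal, LipschitzOnWith L (fun t => (E (u t)).toReal) (Icc a b) := by
  -- The extra unit of time makes the forward quotient at `b` itself available.
  obtain ⟨C, hC0, hC⟩ := hu.exists_lipschitz hκ (b := b + 1) ha
  have hkey : ∀ s ∈ Icc a b, ∀ t ∈ Icc a b,
      (E (u s)).toReal - (E (u t)).toReal ≤ (C ^ 2 + κ / 2 * C ^ 2 * |b - a|) * |s - t| := by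
    intro s hs t ht
    have hfs := hu.energy_lt_top hE hκ (ha.trans_le hs.1)
    have hft := hu.energy_lt_top hE hκ (ha.trans_le ht.1)
    have h := hu.energy_le_at hE hκ (ha.le.trans hs.1)
      (eventually_quotient_of_lipschitz hC ⟨hs.1, by linarith [hs.2]⟩) hft
    rw [← hE.coe_toReal hfs, EReal.coe_le_coe_iff] at h
    have hd := hC s ⟨hs.1, by linarith [hs.2]⟩ t ⟨ht.1, by linarith [ht.2]⟩
    have h1 : C * dist (u s) (u t) ≤ C ^ 2 * |s - t| := by
      nlinarith
    have hst : |s - t| ≤ |b - a| := by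
      refine (abs_le.2 ⟨?_, ?_⟩).trans (le_abs_self _) <;> linarith [hs.1, hs.2, ht.1, ht.2]
    have h2 : dist (u s) (u t) ^ 2 ≤ C ^ 2 * |b - a| * |s - t| := by
      calc dist (u s) (u t) ^ 2 ≤ (C * |s - t|) ^ 2 := by gcongr
        _ = C ^ 2 * |s - t| * |s - t| := by ring
        _ ≤ _ := by gcongr
    have h3 := mul_le_mul_of_nonneg_left h2 (show 0 ≤ κ / 2 by positivity)
    linarith
  refine ⟨(C ^ 2 + κ / 2 * C ^ 2 * |b - a|).toNNReal, LipschitzOnWith.of_dist_le_mul ?_⟩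
  intro s hs t ht
  rw [Real.coe_toNNReal _ (by positivity), Real.dist_eq, Real.dist_eq, abs_le]
  have h1 := hkey s hs t ht
  have h2 := hkey t ht s hs
  rw [abs_sub_comm t s] at h2
  exact ⟨by linarith, h1⟩

lemma IsIntegralFlow.energy_absolutelyContinuous (hE : Setting E) (hκ : 0 ≤ κ)
    (hu : IsIntegralFlow E κ u) {a b : ℝ} (ha : 0 < a) (hab : a ≤ b) :
    AbsolutelyContinuousOnInterval (fun t => (E (u t)).toReal) a b := by
  obtain ⟨L, hL⟩ := hu.exists_lipschitz_energy hE hκ (b := b) ha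
  rw [← uIcc_of_le hab] at hL
  exact hL.absolutelyContinuousOnInterval

/-- The energy dissipation inequality at a differentiability point of the energy. -/
lemma IsIntegralFlow.eventually_dist_sq_le (hE : Setting E) (hκ : 0 ≤ κ)
    (hu : IsIntegralFlow E κ u) {t D : ℝ} (ht : 0 < t)
    (hD : HasDerivAt (fun s => (E (u s)).toReal) D t) {ε : ℝ} (hε : 0 < ε) :
    ∀ᶠ h in 𝓝[>] (0 : ℝ), dist (u (t + h)) (u t) ^ 2 ≤ (-D + ε) * h ^ 2 := by
  set F : ℝ → ℝ := fun s => (E (u s)).toReal with hF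
  obtain ⟨C, hC0, hC⟩ := hu.exists_lipschitz hκ (b := t + 1) ht
  have hslope : ∀ᶠ h in 𝓝[>] (0 : ℝ), F t + (D - ε / 2) * h ≤ F (t + h) := by
    have h1 := (hasDerivAt_iff_tendsto_slope_zero.1 hD).mono_left
      (nhdsWithin_mono _ (fun h (hh : 0 < h) => ne_of_gt hh) : 𝓝[>] (0 : ℝ) ≤ 𝓝[≠] 0)
    filter_upwards [h1.eventually (lt_mem_nhds (show D - ε / 2 < D by linarith)),
      self_mem_nhdsWithin] with h hh hpos
    have hpos' : 0 < h := hpos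
    rw [smul_eq_mul, inv_mul_eq_div, lt_div_iff₀ hpos'] at hh
    linarith
  have hsmall : ∀ᶠ h in 𝓝[>] (0 : ℝ), κ * C ^ 2 * h < ε / 2 := by
    have hc : Tendsto (fun h => κ * C ^ 2 * h) (𝓝 0) (𝓝 (κ * C ^ 2 * 0)) :=
      tendsto_const_nhds.mul tendsto_id
    rw [mul_zero] at hc
    exact (hc.mono_left nhdsWithin_le_nhds).eventually (gt_mem_nhds (by positivity))
  obtain ⟨T, hT, hb⟩ := exists_pos_forall_Ioc_of_eventually hslope
  filter_upwards [hsmall, Ioc_mem_nhdsGT hT, Ioc_mem_nhdsGT (zero_lt_one (α := ℝ))]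
    with h hsm hhT hh1
  have hpos := hhT.1
  have hle : t ≤ t + h := by linarith
  -- Tested with the current point, the terms of order `h` cancel. The second-order term of the
  -- energy integral contributes `-D h²`, up to `ε / 2`, and the distance integral is of order `h³`.
  have hevi := hu.evi (u t) (hu.energy_lt_top hE hκ ht) t (t + h) ht hle
  rw [dist_self, add_sub_cancel_left] at hevi
  have h1 : h * F t + (D - ε / 2) * (h ^ 2 / 2) ≤ ∫ r in t..(t + h), F r := by
    have hi : ∫ r in t..(t + h), (F t + (D - ε / 2) * (r - t)) =
        h * F t + (D - ε / 2) * (h ^ 2 / 2) := by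
      rw [intervalIntegral.integral_add intervalIntegrable_const
        ((by fun_prop : Continuous fun r : ℝ => (D - ε / 2) * (r - t)).intervalIntegrable _ _),
        intervalIntegral.integral_const_mul, intervalIntegral.integral_comp_sub_right (fun r => r)]
      simp
    rw [← hi]
    refine intervalIntegral.integral_mono_on hle
      ((by fun_prop : Continuous fun r : ℝ => F t + (D - ε / 2) * (r - t)).intervalIntegrable _ _)
      (hu.integrable t (t + h) ht hle) fun r hr => ?_
    rcases hr.1.eq_or_lt with rfl | hr0
    · simp
    · have := hb (r - t) ⟨by linarith, by linarith [hr.2, hhT.2]⟩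
      rwa [add_sub_cancel] at this
  have h2 : ∫ r in t..(t + h), dist (u r) (u t) ^ 2 ≤ h * (C * h) ^ 2 := by
    have := intervalIntegral.integral_mono_on hle
      ((intervalIntegrable_iff_integrableOn_Icc_of_le hle).2
        ((continuousOn_dist_const (hu.cont.mono fun r hr => ht.le.trans hr.1) (u t)).pow
          2).integrableOn_Icc)
      (intervalIntegrable_const (c := (C * h) ^ 2) (μ := volume)) (fun r hr => ?_)
    · simpa using this
    · have h3 := hC r ⟨hr.1, by linarith [hr.2, hh1.2]⟩ t ⟨le_rfl, by linarith⟩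
      rw [abs_of_nonneg (sub_nonneg.2 hr.1)] at h3
      have h4 : C * (r - t) ≤ C * h := mul_le_mul_of_nonneg_left (by linarith [hr.2]) hC0
      exact pow_le_pow_left₀ dist_nonneg (h3.trans h4) 2
  have h3 := mul_le_mul_of_nonneg_left h2 hκ
  have h4 : κ * C ^ 2 * h * h ^ 2 ≤ ε / 2 * h ^ 2 :=
    mul_le_mul_of_nonneg_right hsm.le (by positivity)
  simp only [hF] at *
  nlinarith

lemma IsIntegralFlow.deriv_energy_nonpos (hE : Setting E) (hκ : 0 ≤ κ)
    (hu : IsIntegralFlow E κ u) {t D : ℝ} (ht : 0 < t)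
    (hD : HasDerivAt (fun s => (E (u s)).toReal) D t) : D ≤ 0 := by
  by_contra! hpos
  obtain ⟨h, hh, hh0⟩ := ((hu.eventually_dist_sq_le hE hκ ht hD (half_pos hpos)).and
    self_mem_nhdsWithin).exists
  have hh0' : 0 < h := hh0
  nlinarith [sq_nonneg (dist (u (t + h)) (u t)), pow_pos hh0' 2, mul_pos hpos (pow_pos hh0' 2)]

/-- Together with `metricSlope_le_of_quotient` this makes `√(-(E ∘ u)')` dominate both the right
speed and the slope at differentiability points. -/
lemma IsIntegralFlow.eventually_dist_le_of_sqrt_lt (hE : Setting E) (hκ : 0 ≤ κ)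
    (hu : IsIntegralFlow E κ u) {t D q : ℝ} (ht : 0 < t)
    (hD : HasDerivAt (fun s => (E (u s)).toReal) D t) (hq : √(-D) < q) :
    ∀ᶠ h in 𝓝[>] (0 : ℝ), dist (u (t + h)) (u t) ≤ q * h := by
  have hq0 : 0 < q := (Real.sqrt_nonneg _).trans_lt hq
  have hlt : -D < q ^ 2 := (Real.sqrt_lt' hq0).1 hq
  filter_upwards [hu.eventually_dist_sq_le hE hκ ht hD (sub_pos.2 hlt), self_mem_nhdsWithin]
    with h hh hpos
  have hpos' : 0 < h := hpos
  refine le_of_sq_le_sq (hh.trans (le_of_eq ?_)) (by positivity)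
  ring

lemma IsIntegralFlow.metricSlope_le_of_quotient (hE : Setting E) (hκ : 0 ≤ κ)
    (hu : IsIntegralFlow E κ u) {t q : ℝ} (ht : 0 < t) (hq0 : 0 ≤ q)
    (hq : ∀ᶠ h in 𝓝[>] (0 : ℝ), dist (u (t + h)) (u t) ≤ q * h) :
    metricSlope E (u t) ≤ ENNReal.ofReal q :=
  metricSlope_le_of_energy_le hE (hu.energy_lt_top hE hκ ht) hq0
    fun _ hy => hu.energy_le_at hE hκ ht.le hq hy

lemma IsIntegralFlow.integral_deriv_energy (hE : Setting E) (hκ : 0 ≤ κ)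
    (hu : IsIntegralFlow E κ u) {a b : ℝ} (ha : 0 < a) (hab : a ≤ b) :
    ∫⁻ t in Ioc a b, ENNReal.ofReal (-deriv (fun s => (E (u s)).toReal) t) =
        ENNReal.ofReal ((E (u a)).toReal - (E (u b)).toReal) ∧
      (E (u b)).toReal ≤ (E (u a)).toReal := by
  have hac := hu.energy_absolutelyContinuous hE hκ ha hab
  have hint : IntegrableOn (deriv fun s => (E (u s)).toReal) (Ioc a b) := by
    simpa [uIoc_of_le hab] using intervalIntegrable_iff.1 hac.intervalIntegrable_deriv
  have hnn : 0 ≤ᵐ[volume.restrict (Ioc a b)] fun t => -deriv (fun s => (E (u s)).toReal) t := by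
    rw [EventuallyLE, ae_restrict_iff' measurableSet_Ioc]
    filter_upwards [hac.ae_differentiableAt] with t ht hmem
    rw [uIcc_of_le hab] at ht
    exact neg_nonneg.2 (hu.deriv_energy_nonpos hE hκ (ha.trans hmem.1)
      (ht (Ioc_subset_Icc_self hmem)).hasDerivAt)
  have hftc := hac.integral_deriv_eq_sub
  rw [intervalIntegral.integral_of_le hab] at hftc
  have heq : ∫ t in Ioc a b, -deriv (fun s => (E (u s)).toReal) t =
      (E (u a)).toReal - (E (u b)).toReal := by
    rw [integral_neg, hftc]
    ring
  refine ⟨?_, ?_⟩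
  · rw [← heq]
    exact (ofReal_integral_eq_lintegral_ofReal hint.neg hnn).symm
  · have := integral_nonneg_of_ae hnn
    rw [heq] at this
    linarith

end FlowRegularity

/-! ### Affine changes of variable on the line. -/

section AffineSubstitution

lemma lintegral_comp_affine {a : ℝ} (ha : 0 < a) (b s t : ℝ) (f : ℝ → ℝ≥0∞) :
    ∫⁻ r in Ioc s t, ENNReal.ofReal a * f (a * r + b) =
      ∫⁻ r in Ioc (a * s + b) (a * t + b), f r := by
  have h := lintegral_image_eq_lintegral_abs_deriv_mul (s := Ioc s t) measurableSet_Ioc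
    (f := fun r => a * r + b) (f' := fun _ => a)
    (fun r _ => by simpa using (((hasDerivAt_id r).const_mul a).add_const b).hasDerivWithinAt)
    (fun p _ q _ hpq => by simpa [ha.ne'] using hpq) f
  rw [image_affine_Ioc ha, abs_of_pos ha] at h
  exact h.symm

lemma lintegral_comp_one_sub (s t : ℝ) (f : ℝ → ℝ≥0∞) :
    ∫⁻ r in Ioc s t, f (1 - r) = ∫⁻ r in Ioc (1 - t) (1 - s), f r := by
  have h := lintegral_image_eq_lintegral_abs_deriv_mul (s := Ioc s t) measurableSet_Ioc
    (f := fun r => 1 - r) (f' := fun _ => -1)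
    (fun r _ => by simpa using ((hasDerivAt_id r).const_sub 1).hasDerivWithinAt)
    (fun p _ q _ hpq => by simpa using hpq) f
  rw [image_const_sub_Ioc, setLIntegral_congr Ico_ae_eq_Ioc] at h
  simpa using h.symm

lemma ae_comp_affine {a : ℝ} (ha : a ≠ 0) (b : ℝ) {p : ℝ → Prop} (h : ∀ᵐ t, p t) :
    ∀ᵐ t : ℝ, p (a * t + b) := by
  have h1 : ∀ᵐ t : ℝ, p (t + b) :=
    (measurePreserving_add_right volume b).quasiMeasurePreserving.ae h
  have hq : Measure.QuasiMeasurePreserving (fun t : ℝ => a * t) volume volume := by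
    refine ⟨measurable_const_mul a, ?_⟩
    rw [Real.map_volume_mul_left ha]
    exact Measure.smul_absolutelyContinuous
  exact hq.ae h1

end AffineSubstitution

/-! ### Joining points at finite cost. -/

section FiniteJoin

variable {X : Type*} [MetricSpace X] {E : X → EReal} {κ : ℝ} {u w : ℝ → X}

/-- `x` and `y` are joined by a curve along which the metric speed and the slope are both dominated
by a square integrable function. -/
def FiniteJoin (E : X → EReal) (x y : X) : Prop :=
  ∃ (γ : ℝ → X) (g : ℝ → ℝ≥0∞), Measurable g ∧ γ 0 = x ∧ γ 1 = y ∧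
    ∫⁻ t in Ioc (0 : ℝ) 1, g t ^ 2 < ⊤ ∧
    (∀ s t : ℝ, 0 ≤ s → s ≤ t → t ≤ 1 → edist (γ s) (γ t) ≤ ∫⁻ r in Ioc s t, g r) ∧
    ∀ᵐ t : ℝ, t ∈ Ioo (0 : ℝ) 1 → metricSlope E (γ t) ≤ g t

lemma FiniteJoin.symm {x y : X} (h : FiniteJoin E x y) : FiniteJoin E y x := by
  obtain ⟨γ, g, hg, h0, h1, hfin, hd, hs⟩ := h
  refine ⟨fun t => γ (1 - t), fun t => g (1 - t), hg.comp (measurable_const.sub measurable_id),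
    by simpa using h1, by simpa using h0, ?_, fun s t hs0 hst ht1 => ?_, ?_⟩
  · rw [lintegral_comp_one_sub 0 1 (fun t => g t ^ 2)]
    simpa using hfin
  · rw [lintegral_comp_one_sub s t g, edist_comm]
    exact hd _ _ (by linarith) (by linarith) (by linarith)
  · filter_upwards [ae_comp_affine (a := -1) (by norm_num) 1 hs] with t ht hmem
    have := ht ⟨by linarith [hmem.2], by linarith [hmem.1]⟩
    rwa [show -1 * t + 1 = 1 - t by ring] at this

/-- Running each curve at double speed doubles the speed but not the slope. Since `g ≤ 2 g`, the
doubled function still dominates both. -/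
lemma FiniteJoin.trans {x y z : X} (h : FiniteJoin E x y) (h' : FiniteJoin E y z) :
    FiniteJoin E x z := by
  obtain ⟨γ₁, g₁, hg₁, h0₁, h1₁, hfin₁, hd₁, hs₁⟩ := h
  obtain ⟨γ₂, g₂, hg₂, h0₂, h1₂, hfin₂, hd₂, hs₂⟩ := h'
  -- Both halves are written as `2 * t + b` to match `lintegral_comp_affine`.
  set γ : ℝ → X := fun t => if t ≤ 1 / 2 then γ₁ (2 * t + 0) else γ₂ (2 * t + -1) with hγ
  set g : ℝ → ℝ≥0∞ := fun t => if t ≤ 1 / 2 then ENNReal.ofReal 2 * g₁ (2 * t + 0)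
    else ENNReal.ofReal 2 * g₂ (2 * t + -1) with hg
  have hγl : ∀ t, t ≤ 1 / 2 → γ t = γ₁ (2 * t + 0) := fun t ht => if_pos ht
  have hγr : ∀ t, 1 / 2 ≤ t → γ t = γ₂ (2 * t + -1) := fun t ht => by
    rcases ht.eq_or_lt with rfl | ht
    · rw [hγl _ le_rfl]
      norm_num [h1₁, h0₂]
    · exact if_neg (not_le.2 ht)
  have hgl : ∀ s t, t ≤ 1 / 2 → ∀ r ∈ Ioc s t, g r = ENNReal.ofReal 2 * g₁ (2 * r + 0) :=
    fun s t ht r hr => if_pos (hr.2.trans ht)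
  have hgr : ∀ s t, 1 / 2 ≤ s → ∀ r ∈ Ioc s t, g r = ENNReal.ofReal 2 * g₂ (2 * r + -1) :=
    fun s t hs r hr => if_neg (not_le.2 (hs.trans_lt hr.1))
  have hleft : ∀ s t, 0 ≤ s → s ≤ t → t ≤ 1 / 2 → edist (γ s) (γ t) ≤ ∫⁻ r in Ioc s t, g r := by
    intro s t hs hst ht
    rw [setLIntegral_congr_fun measurableSet_Ioc (hgl s t ht),
      lintegral_comp_affine two_pos, hγl s (hst.trans ht), hγl t ht]
    exact hd₁ _ _ (by linarith) (by linarith) (by linarith)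
  have hright : ∀ s t, 1 / 2 ≤ s → s ≤ t → t ≤ 1 → edist (γ s) (γ t) ≤ ∫⁻ r in Ioc s t, g r := by
    intro s t hs hst ht
    rw [setLIntegral_congr_fun measurableSet_Ioc (hgr s t hs),
      lintegral_comp_affine two_pos, hγr s hs, hγr t (hs.trans hst)]
    exact hd₂ _ _ (by linarith) (by linarith) (by linarith)
  have hsplit : ∀ (f : ℝ → ℝ≥0∞) (s t : ℝ), s ≤ 1 / 2 → 1 / 2 ≤ t →
      ∫⁻ r in Ioc s t, f r = (∫⁻ r in Ioc s (1 / 2), f r) + ∫⁻ r in Ioc (1 / 2) t, f r := by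
    intro f s t hs ht
    rw [← Ioc_union_Ioc_eq_Ioc hs ht, lintegral_union measurableSet_Ioc
      (Ioc_disjoint_Ioc_of_le le_rfl)]
  have hsq : ∀ (f : ℝ → ℝ≥0∞) (c s t : ℝ), ∫⁻ r in Ioc s t, (ENNReal.ofReal 2 * f (2 * r + c)) ^ 2 =
      ∫⁻ r in Ioc (2 * s + c) (2 * t + c), ENNReal.ofReal 2 * f r ^ 2 := by
    intro f c s t
    rw [← lintegral_comp_affine two_pos c s t (fun r => ENNReal.ofReal 2 * f r ^ 2)]
    congr 1
    ext r
    ring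
  refine ⟨γ, g, ?_, ?_, ?_, ?_, ?_, ?_⟩
  · exact Measurable.ite measurableSet_Iic
      (measurable_const.mul (hg₁.comp (by fun_prop)))
      (measurable_const.mul (hg₂.comp (by fun_prop)))
  · rw [hγl 0 (by norm_num)]
    norm_num [h0₁]
  · rw [hγr 1 (by norm_num)]
    norm_num [h1₂]
  · have e₁ : ∫⁻ r in Ioc (0 : ℝ) (1 / 2), g r ^ 2 = ENNReal.ofReal 2 * ∫⁻ r in Ioc 0 1, g₁ r ^ 2 := by
      rw [setLIntegral_congr_fun (g := fun r => (ENNReal.ofReal 2 * g₁ (2 * r + 0)) ^ 2)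
        measurableSet_Ioc fun r hr => by simp only [hgl 0 (1 / 2) le_rfl r hr],
        hsq, lintegral_const_mul _ (hg₁.pow_const 2)]
      norm_num
    have e₂ : ∫⁻ r in Ioc (1 / 2 : ℝ) 1, g r ^ 2 = ENNReal.ofReal 2 * ∫⁻ r in Ioc 0 1, g₂ r ^ 2 := by
      rw [setLIntegral_congr_fun (g := fun r => (ENNReal.ofReal 2 * g₂ (2 * r + -1)) ^ 2)
        measurableSet_Ioc fun r hr => by simp only [hgr (1 / 2) 1 le_rfl r hr],
        hsq, lintegral_const_mul _ (hg₂.pow_const 2)]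
      norm_num
    rw [hsplit _ 0 1 (by norm_num) (by norm_num), e₁, e₂]
    exact ENNReal.add_lt_top.2 ⟨ENNReal.mul_lt_top ENNReal.ofReal_lt_top hfin₁,
      ENNReal.mul_lt_top ENNReal.ofReal_lt_top hfin₂⟩
  · intro s t hs hst ht
    rcases le_total t (1 / 2) with h | h
    · exact hleft s t hs hst h
    rcases le_total (1 / 2) s with h2 | h2
    · exact hright s t h2 hst ht
    rw [hsplit g s t h2 h]
    exact (edist_triangle _ (γ (1 / 2)) _).trans
      (add_le_add (hleft s _ hs h2 le_rfl) (hright _ t le_rfl h ht))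
  · filter_upwards [ae_comp_affine two_ne_zero 0 hs₁, ae_comp_affine two_ne_zero (-1) hs₂,
      (by simp [ae_iff, measure_singleton] : ∀ᵐ t : ℝ, t ≠ 1 / 2)] with t ht₁ ht₂ hne hmem
    have hone : ∀ c : ℝ≥0∞, c ≤ ENNReal.ofReal 2 * c := fun c => by
      calc c = 1 * c := (one_mul c).symm
        _ ≤ _ := by gcongr; norm_num
    rcases lt_or_gt_of_ne hne with h | h
    · rw [hγl t h.le, hg]
      simp only [if_pos h.le]
      exact (ht₁ ⟨by linarith [hmem.1], by linarith⟩).trans (hone _)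
    · rw [hγr t h.le, hg]
      simp only [if_neg (not_le.2 h)]
      exact (ht₂ ⟨by linarith, by linarith [hmem.2]⟩).trans (hone _)

/-- A point of finite energy is joined to the time-one point of its flow. -/
lemma IsIntegralFlow.finiteJoin (hE : Setting E) (hκ : 0 ≤ κ) (hu : IsIntegralFlow E κ u)
    (h0 : E (u 0) < ⊤) : FiniteJoin E (u 0) (u 1) := by
  set F : ℝ → ℝ := fun s => (E (u s)).toReal with hF
  have hcont : ContinuousOn u (Icc 0 1) := hu.cont.mono fun t ht => ht.1
  have hdiff : ∀ a b : ℝ, 0 < a → a ≤ b → ∀ᵐ t : ℝ, t ∈ Icc a b → DifferentiableAt ℝ F t := by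
    intro a b ha hab
    have := (hu.energy_absolutelyContinuous hE hκ ha hab).ae_differentiableAt
    rwa [uIcc_of_le hab] at this
  have hlim : ∀ n : ℕ, (0 : ℝ) < 1 / ((n : ℝ) + 1) := fun n => by positivity
  have hle1 : ∀ n : ℕ, 1 / ((n : ℝ) + 1) ≤ 1 := fun n => by
    rw [div_le_one (by positivity)]
    linarith [Nat.cast_nonneg (α := ℝ) n]
  have hdiff' : ∀ᵐ t : ℝ, t ∈ Ioo (0 : ℝ) 1 → DifferentiableAt ℝ F t := by
    have := ae_all_iff.2 fun n : ℕ => hdiff _ 1 (hlim n) (hle1 n)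
    filter_upwards [this] with t ht hmem
    obtain ⟨n, hn⟩ := exists_nat_one_div_lt hmem.1
    exact ht n ⟨hn.le, hmem.2.le⟩
  have hpt : ∀ t : ℝ, 0 < t → DifferentiableAt ℝ F t → ∀ q : ℝ,
      ENNReal.ofReal √(-deriv F t) < ENNReal.ofReal q →
      0 ≤ q ∧ ∀ᶠ h in 𝓝[>] (0 : ℝ), dist (u (t + h)) (u t) ≤ q * h := by
    intro t ht hd q hq
    have hq' := (ENNReal.ofReal_lt_ofReal_iff_of_nonneg (Real.sqrt_nonneg _)).1 hq
    exact ⟨(Real.sqrt_nonneg _).trans hq'.le,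
      hu.eventually_dist_le_of_sqrt_lt hE hκ ht hd.hasDerivAt hq'⟩
  refine ⟨u, fun t => ENNReal.ofReal √(-deriv F t), ?_, rfl, rfl, ?_, ?_, ?_⟩
  · exact ((measurable_deriv F).neg.sqrt).ennreal_ofReal
  · obtain ⟨c, hc⟩ := hE.exists_lower_bound hcont
    obtain ⟨M, hM⟩ := (isCompact_Icc.image_of_continuousOn
      ((continuousOn_dist_const hcont (u 0)).pow 2)).bddAbove
    have hM' : ∀ t ∈ Icc (0 : ℝ) 1, dist (u t) (u 0) ^ 2 ≤ M := fun t ht =>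
      hM (mem_image_of_mem _ ht)
    -- Lower semicontinuity gives no upper bound as `a → 0`. Instead the inequality on `[0, a]` is
    -- tested with `u 0`, bounding the energy below by `F a` through its monotonicity.
    have hup : ∀ a ∈ Ioc (0 : ℝ) 1, F a ≤ (E (u 0)).toReal + κ * M / 2 := by
      intro a ha
      have h := hu.dist_sq_sub_le_of_bounds hE hκ h0 ha.1 (c := F a) (M := M) (fun r hr => by
          rw [← hE.coe_toReal (hu.energy_lt_top hE hκ hr.1), EReal.coe_le_coe_iff]
          exact (hu.integral_deriv_energy hE hκ hr.1 hr.2).2)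
        (fun r hr => hM' r ⟨hr.1.le, hr.2.trans ha.2⟩)
      rw [dist_self] at h
      have h2 : 0 ≤ a * (2 * ((E (u 0)).toReal - F a) + κ * M) := by
        nlinarith [sq_nonneg (dist (u a) (u 0))]
      have h3 := nonneg_of_mul_nonneg_right h2 ha.1
      linarith
    have hb : ∀ n : ℕ, ∫⁻ t in Ioc (1 / ((n : ℝ) + 1)) 1, ENNReal.ofReal √(-deriv F t) ^ 2 ≤
        ENNReal.ofReal ((E (u 0)).toReal + κ * M / 2 - c) := by
      intro n
      have hn : 1 / ((n : ℝ) + 1) ∈ Ioc (0 : ℝ) 1 := ⟨hlim n, hle1 n⟩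
      calc ∫⁻ t in Ioc (1 / ((n : ℝ) + 1)) 1, ENNReal.ofReal √(-deriv F t) ^ 2
          = ∫⁻ t in Ioc (1 / ((n : ℝ) + 1)) 1, ENNReal.ofReal (-deriv F t) := by
            refine setLIntegral_congr_fun_ae measurableSet_Ioc ?_
            filter_upwards [hdiff _ 1 hn.1 hn.2] with t ht hmem
            rw [← ENNReal.ofReal_pow (Real.sqrt_nonneg _), Real.sq_sqrt]
            exact neg_nonneg.2 (hu.deriv_energy_nonpos hE hκ (hn.1.trans hmem.1)
              (ht (Ioc_subset_Icc_self hmem)).hasDerivAt)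
        _ = ENNReal.ofReal (F (1 / ((n : ℝ) + 1)) - F 1) :=
            (hu.integral_deriv_energy hE hκ hn.1 hn.2).1
        _ ≤ _ := by
            refine ENNReal.ofReal_le_ofReal (sub_le_sub (hup _ hn) ?_)
            exact hE.le_toReal (hu.energy_lt_top hE hκ one_pos) (hc 1 (by simp))
    -- The energy is known to be absolutely continuous only away from `0`; the uniform bounds on
    -- these intervals pass to their increasing union.
    have hU : Ioc (0 : ℝ) 1 = ⋃ n : ℕ, Ioc (1 / ((n : ℝ) + 1)) 1 := by
      ext t
      simp only [mem_Ioc, mem_iUnion]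
      constructor
      · rintro ⟨h1, h2⟩
        obtain ⟨n, hn⟩ := exists_nat_one_div_lt h1
        exact ⟨n, hn, h2⟩
      · rintro ⟨n, h1, h2⟩
        exact ⟨(hlim n).trans h1, h2⟩
    rw [hU, setLIntegral_iUnion_of_directed]
    · exact (iSup_le hb).trans_lt ENNReal.ofReal_lt_top
    · refine directed_of_isDirected_le fun n m hnm => Ioc_subset_Ioc_left ?_
      gcongr
  · have hpos : ∀ s t : ℝ, 0 < s → s ≤ t → t ≤ 1 →
        edist (u s) (u t) ≤ ∫⁻ r in Ioc s t, ENNReal.ofReal √(-deriv F r) := by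
      intro s t hs hst ht
      obtain ⟨C, hC0, hC⟩ := hu.exists_lipschitz hκ (b := t) hs
      have hlip : LipschitzOnWith C.toNNReal u (uIcc s t) := by
        rw [uIcc_of_le hst]
        refine LipschitzOnWith.of_dist_le_mul fun p hp q hq => ?_
        rw [Real.coe_toNNReal _ hC0, Real.dist_eq]
        exact hC p hp q hq
      refine (edist_le_lintegral_of_frequently hst hlip.absolutelyContinuousOnInterval ?_).1
      filter_upwards [hdiff s t hs hst] with r hr hmem q hq
      have hev := (hpt r (hs.trans hmem.1) (hr (Ioo_subset_Icc_self hmem)) q hq).2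
      have htend : Tendsto (fun h : ℝ => r + h) (𝓝[>] 0) (𝓝[≠] r) := by
        refine tendsto_nhdsWithin_iff.2 ⟨?_, ?_⟩
        · have : Tendsto (fun h : ℝ => r + h) (𝓝 0) (𝓝 (r + 0)) :=
            tendsto_const_nhds.add tendsto_id
          rw [add_zero] at this
          exact this.mono_left nhdsWithin_le_nhds
        · filter_upwards [self_mem_nhdsWithin] with h hh
          simpa using (ne_of_gt hh)
      refine htend.frequently (Eventually.frequently ?_)
      filter_upwards [hev, self_mem_nhdsWithin] with h hh hpos
      rwa [add_sub_cancel_left, abs_of_pos (mem_Ioi.1 hpos)]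
    intro s t hs hst ht
    rcases hs.eq_or_lt with rfl | hs
    · rcases hst.eq_or_lt with rfl | hst
      · simp
      refine le_of_tendsto (hu.tendsto_zero.edist tendsto_const_nhds) ?_
      filter_upwards [Ioc_mem_nhdsGT hst] with s hs
      exact (hpos s t hs.1 hs.2 ht).trans (lintegral_mono_set (Ioc_subset_Ioc_left hs.1.le))
    · exact hpos s t hs hst ht
  · filter_upwards [hdiff'] with t ht hmem
    refine le_of_forall_gt_imp_ge_of_dense fun c hc => ?_
    obtain ⟨q, -, hq1, hq2⟩ := ENNReal.lt_iff_exists_real_btwn.1 hc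
    obtain ⟨hq0, hq⟩ := hpt t hmem.1 (ht hmem) q hq1
    exact (hu.metricSlope_le_of_quotient hE hκ hmem.1 hq0 hq).trans hq2.le

end FiniteJoin

/-! ### A competitor of finite action. -/

section Competitor

variable {X : Type*} [MetricSpace X] {E : X → EReal} {κ : ℝ} {u w : ℝ → X}

/-- The slope at time one is bounded, uniformly for flows that start in a bounded set. -/
lemma exists_metricSlope_bound (hE : Setting E) (hκ : 0 ≤ κ) (hw : IsIntegralFlow E κ w)
    (h0 : E (w 0) < ⊤) (R : ℝ) :
    ∃ S : ℝ, ∀ u : ℝ → X, IsIntegralFlow E κ u → dist (u 0) (w 0) ≤ R →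
      metricSlope E (u 1) ≤ ENNReal.ofReal S := by
  obtain ⟨M₀, hM₀⟩ := (isCompact_Icc.image_of_continuousOn
    (continuousOn_dist_const (hw.cont.mono fun t (ht : t ∈ Icc (0 : ℝ) 1) => ht.1)
      (w 0))).bddAbove
  have hM₀' : ∀ t ∈ Icc (0 : ℝ) 1, dist (w t) (w 0) ≤ M₀ := fun t ht => hM₀ (mem_image_of_mem _ ht)
  set M := Real.exp κ * R + M₀ with hM
  obtain ⟨c, hc⟩ := hE.bounded_below (Metric.closedBall (w 0) M) Metric.isBounded_closedBall
  -- `M` bounds the distance to `w 0` on `[0, 1]` by contraction. `K` bounds the energy at time `1 /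
  -- 2`, by the inequality tested with `w 0`, and `c` bounds the energy at time `1` from below.
  set K := (E (w 0)).toReal + κ * M ^ 2 / 2 + R ^ 2 with hK
  set Λ := 2 * (K - c) + 1 with hΛ
  refine ⟨Real.exp κ * (√Λ + 1), fun u hu hR => ?_⟩
  have hR0 : 0 ≤ R := dist_nonneg.trans hR
  have hdist : ∀ t ∈ Icc (0 : ℝ) 1, dist (u t) (w 0) ≤ M := by
    intro t ht
    refine (dist_triangle _ (w t) _).trans (add_le_add ?_ (hM₀' t ht))
    refine (hu.dist_le hκ hw le_rfl ht.1).trans ?_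
    refine mul_le_mul (Real.exp_le_exp.2 ?_) hR dist_nonneg (Real.exp_pos _).le
    nlinarith [ht.2]
  set F : ℝ → ℝ := fun s => (E (u s)).toReal with hF
  have hup : F (1 / 2) ≤ K := by
    have h := hu.dist_sq_sub_le_of_bounds hE hκ h0 (t := 1 / 2) (by norm_num) (c := F (1 / 2))
      (M := M ^ 2) (fun r hr => by
        rw [← hE.coe_toReal (hu.energy_lt_top hE hκ hr.1), EReal.coe_le_coe_iff]
        exact (hu.integral_deriv_energy hE hκ hr.1 hr.2).2)
      (fun r hr => pow_le_pow_left₀ dist_nonneg (hdist r ⟨hr.1.le, hr.2.trans (by norm_num)⟩) 2)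
    have h2 : dist (u 0) (w 0) ^ 2 ≤ R ^ 2 := pow_le_pow_left₀ dist_nonneg hR 2
    nlinarith [sq_nonneg (dist (u (1 / 2)) (w 0))]
  have hlow : c ≤ F 1 := hE.le_toReal (hu.energy_lt_top hE hκ one_pos)
    (hc _ (Metric.mem_closedBall.2 (hdist 1 (by simp))))
  obtain ⟨hint, hmono⟩ := hu.integral_deriv_energy hE hκ (a := 1 / 2) (b := 1) (by norm_num)
    (by norm_num)
  have hdiff := (hu.energy_absolutelyContinuous hE hκ (a := 1 / 2) (b := 1) (by norm_num)
    (by norm_num)).ae_differentiableAt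
  rw [uIcc_of_le (by norm_num)] at hdiff
  -- If the dissipation exceeded `Λ` almost everywhere on an interval of length `1 / 2`, the energy
  -- would drop by at least `Λ / 2 = K - c + 1 / 2`. The speed bound at such a time then propagates
  -- to time `1`.
  obtain ⟨t, htmem, htd, htΛ⟩ : ∃ t ∈ Ioc (1 / 2 : ℝ) 1, DifferentiableAt ℝ F t ∧
      -deriv F t ≤ Λ := by
    by_contra! hcon
    have hΛle : ∀ᵐ t ∂volume.restrict (Ioc (1 / 2 : ℝ) 1),
        ENNReal.ofReal Λ ≤ ENNReal.ofReal (-deriv F t) := by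
      rw [ae_restrict_iff' measurableSet_Ioc]
      filter_upwards [hdiff] with t ht hmem
      exact ENNReal.ofReal_le_ofReal (hcon t hmem (ht (Ioc_subset_Icc_self hmem))).le
    have h1 := lintegral_mono_ae hΛle
    rw [hint, lintegral_const, Measure.restrict_apply_univ, Real.volume_Ioc,
      ← ENNReal.ofReal_mul (by simp only [hΛ]; linarith),
      ENNReal.ofReal_le_ofReal_iff (sub_nonneg.2 hmono)] at h1
    simp only [hΛ, hF] at *
    linarith
  have htpos : 0 < t := by linarith [htmem.1]
  have hq := hu.eventually_dist_le_of_sqrt_lt hE hκ htpos htd.hasDerivAt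
    (q := √Λ + 1) ((Real.sqrt_le_sqrt htΛ).trans_lt (by linarith))
  refine hu.metricSlope_le_of_quotient hE hκ one_pos (by positivity) ?_
  filter_upwards [hq, self_mem_nhdsWithin] with h hh hpos
  have hpos' : 0 < h := hpos
  refine (hu.dist_add_le hκ htpos.le htmem.2 hpos'.le).trans ?_
  rw [mul_assoc]
  refine mul_le_mul (Real.exp_le_exp.2 ?_) hh dist_nonneg (Real.exp_pos _).le
  nlinarith

/-- Absolutely continuous curves can be reparametrized to be Lipschitz. -/
lemma ACOn.exists_lipschitz_reparametrization {γ : ℝ → X} (h : ACOn γ 0 1) :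
    ∃ (η : ℝ → X) (ℓ : ℝ), 0 ≤ ℓ ∧ η 0 = γ 0 ∧ η 1 = γ 1 ∧
      ∀ s ∈ Icc (0 : ℝ) 1, ∀ t ∈ Icc (0 : ℝ) 1, dist (η s) (η t) ≤ ℓ * |s - t| := by
  obtain ⟨m, hm, hd⟩ := h
  have hmabs : IntegrableOn (fun r => |m r|) (Icc 0 1) := hm.abs
  have hii : ∀ s t : ℝ, 0 ≤ s → s ≤ t → t ≤ 1 → IntervalIntegrable m volume s t :=
    fun s t hs hst ht => (intervalIntegrable_iff_integrableOn_Icc_of_le hst).2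
      (hm.mono_set (Icc_subset_Icc hs ht))
  have hd' : ∀ s t : ℝ, 0 ≤ s → s ≤ t → t ≤ 1 → dist (γ s) (γ t) ≤ ∫ r in s..t, |m r| :=
    fun s t hs hst ht => (hd s t hs hst ht).trans
      (intervalIntegral.integral_mono_on hst (hii s t hs hst ht) (hii s t hs hst ht).abs
        fun r _ => le_abs_self _)
  set L : ℝ → ℝ := fun t => ∫ r in (0 : ℝ)..t, |m r| with hL
  have hLc : ContinuousOn L (Icc 0 1) := by
    have := intervalIntegral.continuousOn_primitive_interval'
      (hii 0 1 le_rfl zero_le_one le_rfl).abs left_mem_uIcc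
    rwa [uIcc_of_le zero_le_one] at this
  have hL0 : L 0 = 0 := intervalIntegral.integral_same
  have hL1 : 0 ≤ L 1 := intervalIntegral.integral_nonneg zero_le_one fun r _ => abs_nonneg _
  have hivt : ∀ s ∈ Icc (0 : ℝ) 1, ∃ τ ∈ Icc (0 : ℝ) 1, L τ = L 1 * s := by
    intro s hs
    have := intermediate_value_Icc zero_le_one hLc
    rw [hL0] at this
    exact this ⟨mul_nonneg hL1 hs.1, mul_le_of_le_one_right hL1 hs.2⟩
  -- The preimages may be chosen arbitrarily: increments of `γ` are bounded by those of `L`, so `γ`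
  -- is constant on the fibres of `L`.
  choose! τ hτ hLτ using hivt
  have hdist : ∀ s ∈ Icc (0 : ℝ) 1, ∀ t ∈ Icc (0 : ℝ) 1, dist (γ s) (γ t) ≤ |L s - L t| :=
    fun s hs t ht => dist_le_abs_integral hd' hmabs hs ht
  have hz : (0 : ℝ) ∈ Icc (0 : ℝ) 1 := by simp
  have ho : (1 : ℝ) ∈ Icc (0 : ℝ) 1 := by simp
  refine ⟨fun s => γ (τ s), L 1, hL1, ?_, ?_, fun s hs t ht => ?_⟩
  · have := hdist _ (hτ 0 hz) 0 hz
    rw [hLτ 0 hz, hL0] at this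
    exact dist_le_zero.1 (this.trans (by simp))
  · have := hdist _ (hτ 1 ho) 1 ho
    rw [hLτ 1 ho] at this
    exact dist_le_zero.1 (this.trans (by simp))
  · refine (hdist _ (hτ s hs) _ (hτ t ht)).trans ?_
    rw [hLτ s hs, hLτ t ht, ← mul_sub, abs_mul, abs_of_nonneg hL1]

/-- Three pieces: the flow from one endpoint up to time one, the time-one image of the Lipschitz
curve `η`, and the flow from the other endpoint reversed. The middle piece needs no energy bound
along `γ`. -/
lemma finiteJoin_of_ACOn (hE : Setting E) {γ : ℝ → X} (hγ : ACOn γ 0 1) (h0 : E (γ 0) < ⊤)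
    (h1 : E (γ 1) < ⊤) : FiniteJoin E (γ 0) (γ 1) := by
  obtain ⟨κ, hκ, hflow⟩ := hE.exists_isIntegralFlow
  choose U hU hU0 using hflow
  obtain ⟨η, ℓ, hℓ, hη0, hη1, hη⟩ := hγ.exists_lipschitz_reparametrization
  have hleft : FiniteJoin E (γ 0) (U (γ 0) 1) := by
    have := (hU (γ 0)).finiteJoin hE hκ (by rwa [hU0])
    rwa [hU0] at this
  have hright : FiniteJoin E (γ 1) (U (γ 1) 1) := by
    have := (hU (γ 1)).finiteJoin hE hκ (by rwa [hU0])
    rwa [hU0] at this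
  obtain ⟨S, hS⟩ := exists_metricSlope_bound hE hκ (hU (γ 0)) (by rwa [hU0]) ℓ
  refine (hleft.trans ?_).trans hright.symm
  -- The first entry is the Lipschitz constant of the time-one image, the second its uniform slope
  -- bound.
  set C := max (Real.exp κ * ℓ) S with hC
  refine ⟨fun t => U (η t) 1, fun _ => ENNReal.ofReal C, measurable_const, by simp [hη0],
    by simp [hη1], by simp, ?_, ?_⟩
  · intro s t hs hst ht
    rw [lintegral_const, Measure.restrict_apply_univ, Real.volume_Ioc, edist_dist,
      ← ENNReal.ofReal_mul (le_max_of_le_left (by positivity))]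
    refine ENNReal.ofReal_le_ofReal ?_
    have h1 := (hU (η s)).dist_le hκ (hU (η t)) le_rfl zero_le_one
    rw [hU0, hU0, sub_zero, mul_one] at h1
    have h2 := hη s ⟨hs, hst.trans ht⟩ t ⟨hs.trans hst, ht⟩
    rw [abs_sub_comm, abs_of_nonneg (sub_nonneg.2 hst)] at h2
    calc dist (U (η s) 1) (U (η t) 1) ≤ Real.exp κ * dist (η s) (η t) := h1
      _ ≤ Real.exp κ * (ℓ * (t - s)) := by gcongr
      _ = Real.exp κ * ℓ * (t - s) := by ring
      _ ≤ C * (t - s) := mul_le_mul_of_nonneg_right (le_max_left _ _) (sub_nonneg.2 hst)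
  · refine .of_forall fun t ht => ?_
    refine (hS (U (η t)) (hU _) ?_).trans (ENNReal.ofReal_le_ofReal (le_max_right _ _))
    rw [hU0, hU0, ← hη0]
    refine (hη t (Ioo_subset_Icc_self ht) 0 (by simp)).trans ?_
    rw [sub_zero, abs_of_pos ht.1]
    exact mul_le_of_le_one_right hℓ ht.2.le

lemma lintegral_Icc_eq_Ioc (f : ℝ → ℝ≥0∞) (a b : ℝ) :
    ∫⁻ t in Icc a b, f t = ∫⁻ t in Ioc a b, f t := setLIntegral_congr Ioc_ae_eq_Icc.symm

/-- Curves whose increments are dominated by a square integrable function are absolutely continuous,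
and the function dominates the metric speed. -/
lemma ACOn_of_edist_le_lintegral {γ : ℝ → X} {g : ℝ → ℝ≥0∞} (hg : Measurable g)
    (hfin : ∫⁻ t in Ioc (0 : ℝ) 1, g t ^ 2 < ⊤)
    (hd : ∀ s t : ℝ, 0 ≤ s → s ≤ t → t ≤ 1 → edist (γ s) (γ t) ≤ ∫⁻ r in Ioc s t, g r) :
    ACOn γ 0 1 ∧ ∀ᵐ t ∂volume.restrict (Icc (0 : ℝ) 1), metricSpeed γ t ≤ g t := by
  have hfin1 : ∫⁻ t in Icc (0 : ℝ) 1, g t < ⊤ := by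
    have := sq_lintegral_le_measure_mul (μ := volume.restrict (Ioc (0 : ℝ) 1)) hg.aemeasurable
    rw [Measure.restrict_apply_univ, Real.volume_Ioc, sub_zero, ENNReal.ofReal_one, one_mul] at this
    rw [lintegral_Icc_eq_Ioc]
    exact (ENNReal.pow_lt_top_iff.1 (this.trans_lt hfin)).resolve_right two_ne_zero
  have hglt : ∀ᵐ t ∂volume.restrict (Icc (0 : ℝ) 1), g t < ⊤ := ae_lt_top hg hfin1.ne
  have hmint : IntegrableOn (fun t => (g t).toReal) (Icc 0 1) :=
    integrable_toReal_of_lintegral_ne_top hg.aemeasurable hfin1.ne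
  have hdm : ∀ s t : ℝ, 0 ≤ s → s ≤ t → t ≤ 1 → dist (γ s) (γ t) ≤ ∫ r in s..t, (g r).toReal := by
    intro s t hs hst ht
    have hsub : Ioc s t ⊆ Icc 0 1 := fun r hr => ⟨hs.trans hr.1.le, hr.2.trans ht⟩
    rw [intervalIntegral.integral_of_le hst,
      integral_toReal hg.aemeasurable (ae_restrict_of_ae_restrict_of_subset hsub hglt), dist_edist]
    exact ENNReal.toReal_mono ((lintegral_mono_set hsub).trans_lt hfin1).ne (hd s t hs hst ht)
  refine ⟨⟨_, hmint, hdm⟩, ?_⟩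
  have hspeed : ∀ᵐ t ∂volume.restrict (Icc (0 : ℝ) 1),
      metricSpeed γ t ≤ ENNReal.ofReal |(g t).toReal| := by
    rw [← restrict_Ioo_eq_restrict_Icc]
    exact (ae_restrict_iff' measurableSet_Ioo).2
      (metricSpeed_le_of_dist_le_integral zero_le_one hmint hdm)
  filter_upwards [hspeed, hglt] with t ht hlt
  rwa [abs_of_nonneg ENNReal.toReal_nonneg, ENNReal.ofReal_toReal hlt.ne] at ht

lemma FiniteJoin.exists_action_lt_top {x y : X} (h : FiniteJoin E x y) (ε : ℝ) :
    ∃ γ ∈ curvesJoining x y, schrodingerAction E ε γ < ⊤ := by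
  obtain ⟨γ, g, hg, h0, h1, hfin, hd, hs⟩ := h
  obtain ⟨hAC, hspeed⟩ := ACOn_of_edist_le_lintegral hg hfin hd
  refine ⟨γ, ⟨hAC.continuousOn zero_le_one, h0, h1⟩, ?_⟩
  rw [← lintegral_Icc_eq_Ioc] at hfin
  have hkin : ∫⁻ t in Icc (0 : ℝ) 1, metricSpeed γ t ^ 2 < ⊤ := by
    refine lt_of_le_of_lt (lintegral_mono_ae ?_) hfin
    filter_upwards [hspeed] with t ht
    gcongr
  have hfis : ∫⁻ t in Icc (0 : ℝ) 1, metricSlope E (γ t) ^ 2 < ⊤ := by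
    refine lt_of_le_of_lt (lintegral_mono_ae ?_) hfin
    rw [← restrict_Ioo_eq_restrict_Icc]
    filter_upwards [(ae_restrict_iff' measurableSet_Ioo).2 hs] with t ht
    gcongr
  rw [schrodingerAction, kineticEnergy, if_pos hAC, fisherInformation]
  exact ENNReal.add_lt_top.2 ⟨ENNReal.mul_lt_top (by simp) hkin,
    ENNReal.mul_lt_top ENNReal.ofReal_lt_top (ENNReal.mul_lt_top (by simp) hfis)⟩

end Competitor

/-! ### Kinetic energy through quadratic sums, stable under pointwise limits. -/

section QuadraticVariation

variable {X : Type*} [MetricSpace X]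

/-- The sums `∑ d²(γ_{a_i}, γ_{b_i}) / |b_i - a_i|` over disjoint intervals are bounded by `k`. -/
def QuadraticSumLE (γ : ℝ → X) (k : ℝ≥0∞) : Prop :=
  ∀ (n : ℕ) (I : ℕ → ℝ × ℝ),
    Set.PairwiseDisjoint (Finset.range n : Set ℕ) (fun i => uIoc (I i).1 (I i).2) →
    ∑ i ∈ Finset.range n, edist (γ (I i).1) (γ (I i).2) ^ 2 / edist (I i).1 (I i).2 ≤ k

/-- The projection of the real line onto the unit interval. -/
def clamp (t : ℝ) : ℝ := max 0 (min t 1)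

lemma clamp_mem (t : ℝ) : clamp t ∈ Icc (0 : ℝ) 1 :=
  ⟨le_max_left _ _, max_le zero_le_one (min_le_right _ _)⟩

lemma clamp_of_mem {t : ℝ} (ht : t ∈ Icc (0 : ℝ) 1) : clamp t = t := by
  rw [clamp, min_eq_left ht.2, max_eq_right ht.1]

lemma clamp_mono : Monotone clamp := fun s t h => by
  unfold clamp
  gcongr

lemma continuous_clamp : Continuous clamp := by
  unfold clamp
  fun_prop

lemma clamp_sub_le {s t : ℝ} (h : s ≤ t) : clamp t - clamp s ≤ t - s := by
  unfold clamp
  rcases le_total s 1 with h1 | h1 <;> rcases le_total t 1 with h2 | h2 <;>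
    simp only [min_eq_left, min_eq_right, h1, h2] <;>
    rcases le_total 0 s with h3 | h3 <;> rcases le_total 0 t with h4 | h4 <;>
    simp only [max_eq_left, max_eq_right, h3, h4, zero_le_one] <;> linarith

lemma Ioc_clamp_subset (s t : ℝ) : Ioc (clamp s) (clamp t) ⊆ Ioc s t ∩ Icc 0 1 := by
  intro r hr
  have hr01 : r ∈ Icc (0 : ℝ) 1 := ⟨(clamp_mem s).1.trans hr.1.le, hr.2.trans (clamp_mem t).2⟩
  have hcr := clamp_of_mem hr01
  refine ⟨⟨?_, ?_⟩, hr01⟩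
  · by_contra! h
    have := clamp_mono h
    rw [hcr] at this
    exact absurd hr.1 (not_lt.2 this)
  · rcases le_or_gt t 1 with h1 | h1
    · rcases le_total 0 t with h0 | h0
      · exact (clamp_of_mem (t := t) ⟨h0, h1⟩).symm ▸ hr.2
      · have h2 := hr.2
        rw [clamp, min_eq_left h1, max_eq_left h0] at h2
        exact absurd (lt_of_le_of_lt (clamp_mem s).1 hr.1) (not_lt.2 h2)
    · exact hr01.2.trans h1.le

/-- Cauchy–Schwarz on each interval and additivity of the measure with density the squared speed.
Clamping makes the estimates valid on the whole line. -/
lemma ACOn.quadraticSumLE {γ : ℝ → X} (h : ACOn γ 0 1) :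
    QuadraticSumLE (fun t => γ (clamp t)) (∫⁻ t in Icc (0 : ℝ) 1, metricSpeed γ t ^ 2) := by
  set ν : Measure ℝ := (volume.restrict (Icc (0 : ℝ) 1)).withDensity
    (fun t => metricSpeed γ t ^ 2) with hν
  have hord : ∀ a b : ℝ, a ≤ b →
      edist (γ (clamp a)) (γ (clamp b)) ^ 2 ≤ ENNReal.ofReal (b - a) * ν (Ioc a b) := by
    intro a b hab
    refine (h.edist_sq_le (clamp_mem a).1 (clamp_mono hab) (clamp_mem b).2).trans ?_
    rw [hν, withDensity_apply _ measurableSet_Ioc, Measure.restrict_restrict measurableSet_Ioc]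
    exact mul_le_mul' (ENNReal.ofReal_le_ofReal (clamp_sub_le hab))
      (lintegral_mono_set (Ioc_clamp_subset a b))
  have hgen : ∀ a b : ℝ,
      edist (γ (clamp a)) (γ (clamp b)) ^ 2 ≤ ν (uIoc a b) * edist a b := by
    intro a b
    rw [mul_comm, edist_dist a b, Real.dist_eq]
    rcases le_total a b with hab | hab
    · rw [uIoc_of_le hab, abs_sub_comm, abs_of_nonneg (sub_nonneg.2 hab)]
      exact hord a b hab
    · rw [uIoc_of_ge hab, abs_of_nonneg (sub_nonneg.2 hab), edist_comm]
      exact hord b a hab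
  intro n I hI
  calc ∑ i ∈ Finset.range n, edist (γ (clamp (I i).1)) (γ (clamp (I i).2)) ^ 2 /
        edist (I i).1 (I i).2
      ≤ ∑ i ∈ Finset.range n, ν (uIoc (I i).1 (I i).2) :=
        Finset.sum_le_sum fun i _ => ENNReal.div_le_of_le_mul (hgen _ _)
    _ = ν (⋃ i ∈ Finset.range n, uIoc (I i).1 (I i).2) :=
        (measure_biUnion_finset hI fun i _ => measurableSet_uIoc).symm
    _ ≤ ν univ := measure_mono (subset_univ _)
    _ = _ := by rw [hν, withDensity_apply _ MeasurableSet.univ, Measure.restrict_univ]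

lemma liminf_add_liminf_le (f g : ℕ → ℝ≥0∞) :
    liminf f atTop + liminf g atTop ≤ liminf (fun n => f n + g n) atTop := by
  have hmono : ∀ h : ℕ → ℝ≥0∞, Monotone fun n => ⨅ i, ⨅ (_ : i ≥ n), h i := fun h n m hnm =>
    le_iInf₂ fun i hi => iInf₂_le i (hnm.trans hi)
  simp only [liminf_eq_iSup_iInf_of_nat]
  rw [ENNReal.iSup_add_iSup_of_monotone (hmono f) (hmono g)]
  exact iSup_mono fun n => le_iInf₂ fun i hi => add_le_add (iInf₂_le i hi) (iInf₂_le i hi)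

lemma sum_liminf_le_liminf_sum {ι : Type*} (s : Finset ι) (f : ι → ℕ → ℝ≥0∞) :
    ∑ i ∈ s, liminf (f i) atTop ≤ liminf (fun n => ∑ i ∈ s, f i n) atTop := by
  classical
  induction s using Finset.induction_on with
  | empty => simp
  | insert i s hi ih =>
    simp only [Finset.sum_insert hi]
    exact (add_le_add le_rfl ih).trans
      (liminf_add_liminf_le _ _)

lemma sq_liminf_div {f : ℕ → ℝ≥0∞} (c : ℝ≥0∞) (hc : c ≠ 0) :
    (liminf f atTop) ^ 2 / c = liminf (fun n => f n ^ 2 / c) atTop := by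
  have hmono : Monotone fun z : ℝ≥0∞ => z ^ 2 / c := fun a b h => by
    simp only
    gcongr
  have hcont : Continuous fun z : ℝ≥0∞ => z ^ 2 / c :=
    (ENNReal.continuous_div_const c hc).comp (ENNReal.continuous_pow 2)
  exact hmono.map_liminf_of_continuousAt f hcont.continuousAt

/-- This is the lower semicontinuity of the kinetic energy: each sum is finite, so semicontinuity of
individual distances is enough. -/
lemma QuadraticSumLE.of_liminf {c : ℕ → ℝ → X} {k : ℕ → ℝ≥0∞} {Γ : ℝ → X}
    (hc : ∀ n, QuadraticSumLE (c n) (k n))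
    (hΓ : ∀ s t, edist (Γ s) (Γ t) ≤ liminf (fun n => edist (c n s) (c n t)) atTop) :
    QuadraticSumLE Γ (liminf k atTop) := by
  intro n I hI
  calc ∑ i ∈ Finset.range n, edist (Γ (I i).1) (Γ (I i).2) ^ 2 / edist (I i).1 (I i).2
      ≤ ∑ i ∈ Finset.range n, liminf (fun m =>
          edist (c m (I i).1) (c m (I i).2) ^ 2 / edist (I i).1 (I i).2) atTop := by
        refine Finset.sum_le_sum fun i _ => ?_
        -- A degenerate interval contributes `0 ^ 2 / 0 = 0`; division is continuous only for a
        -- nonzero denominator.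
        by_cases h0 : edist (I i).1 (I i).2 = 0
        · rw [edist_eq_zero.1 h0]
          simp
        rw [← sq_liminf_div _ h0]
        gcongr
        exact hΓ _ _
    _ ≤ liminf (fun m => ∑ i ∈ Finset.range n,
          edist (c m (I i).1) (c m (I i).2) ^ 2 / edist (I i).1 (I i).2) atTop :=
        sum_liminf_le_liminf_sum _ _
    _ ≤ liminf k atTop := liminf_le_liminf (.of_forall fun m => hc m n I hI)

lemma QuadraticSumLE.edist_sq_le {Γ : ℝ → X} {k : ℝ≥0∞} (h : QuadraticSumLE Γ k) (s t : ℝ) :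
    edist (Γ s) (Γ t) ^ 2 ≤ k * edist s t := by
  by_cases h0 : edist s t = 0
  · rw [edist_eq_zero.1 h0]
    simp
  have := h 1 (fun _ => (s, t)) (by simp)
  rw [Finset.sum_range_one] at this
  exact (ENNReal.div_le_iff_le_mul (Or.inl h0) (Or.inl (edist_ne_top _ _))).1 this

lemma QuadraticSumLE.dist_sq_le {Γ : ℝ → X} {k : ℝ≥0∞} (hk : k < ⊤) (h : QuadraticSumLE Γ k)
    (s t : ℝ) : dist (Γ s) (Γ t) ^ 2 ≤ k.toReal * |s - t| := by
  have := ENNReal.toReal_mono (ENNReal.mul_ne_top hk.ne (edist_ne_top _ _)) (h.edist_sq_le s t)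
  rwa [ENNReal.toReal_pow, ENNReal.toReal_mul, ← dist_edist, ← dist_edist, Real.dist_eq] at this

lemma QuadraticSumLE.continuous {Γ : ℝ → X} {k : ℝ≥0∞} (hk : k < ⊤) (h : QuadraticSumLE Γ k) :
    Continuous Γ := by
  refine continuous_iff_continuousAt.2 fun t => tendsto_iff_dist_tendsto_zero.2 ?_
  have hlim : Tendsto (fun s => √(k.toReal * |s - t|)) (𝓝 t) (𝓝 √(k.toReal * |t - t|)) := by
    have : Continuous fun s => √(k.toReal * |s - t|) := by fun_prop
    exact this.continuousAt
  rw [sub_self, abs_zero, mul_zero, Real.sqrt_zero] at hlim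
  exact squeeze_zero (fun _ => dist_nonneg)
    (fun s => Real.le_sqrt_of_sq_le (h.dist_sq_le hk s t)) hlim

lemma QuadraticSumLE.absolutelyContinuous {Γ : ℝ → X} {k : ℝ≥0∞} (hk : k < ⊤)
    (h : QuadraticSumLE Γ k) (a b : ℝ) : AbsolutelyContinuousOnInterval Γ a b := by
  rw [absolutelyContinuousOnInterval_iff]
  intro ε hε
  -- By Cauchy–Schwarz the squared sum of increments is at most `k` times the total length; the `+
  -- 1` covers `k = 0`.
  refine ⟨ε ^ 2 / (k.toReal + 1), by positivity, fun I hI hlen => ?_⟩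
  obtain ⟨n, I⟩ := I
  have hsum := h n I hI.2
  have hreal : ∑ i ∈ Finset.range n, dist (Γ (I i).1) (Γ (I i).2) ^ 2 / dist (I i).1 (I i).2 ≤
      k.toReal := by
    have := ENNReal.toReal_mono hk.ne hsum
    rw [ENNReal.toReal_sum (fun i hi => ne_top_of_le_ne_top (hsum.trans_lt hk).ne
      (Finset.single_le_sum (f := fun i => edist (Γ (I i).1) (Γ (I i).2) ^ 2 /
        edist (I i).1 (I i).2) (fun _ _ => zero_le) hi))] at this
    simpa [dist_edist] using this
  have hcs := Finset.sum_sq_le_sum_mul_sum_of_sq_le_mul (Finset.range n)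
    (r := fun i => dist (Γ (I i).1) (Γ (I i).2)) (f := fun i => dist (I i).1 (I i).2)
    (g := fun i => dist (Γ (I i).1) (Γ (I i).2) ^ 2 / dist (I i).1 (I i).2)
    (fun _ _ => dist_nonneg) (fun _ _ => by positivity) (fun i _ => by
      by_cases h0 : dist (I i).1 (I i).2 = 0
      · rw [dist_eq_zero.1 h0]
        simp
      · exact le_of_eq (by field_simp))
  refine lt_of_pow_lt_pow_left₀ 2 hε.le (hcs.trans_lt ?_)
  rw [lt_div_iff₀ (by positivity)] at hlen
  have hlen0 : 0 ≤ ∑ i ∈ Finset.range n, dist (I i).1 (I i).2 :=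
    Finset.sum_nonneg fun _ _ => dist_nonneg
  simp only at hlen ⊢
  nlinarith [mul_le_mul_of_nonneg_left hreal hlen0]

lemma lintegral_Ioc_zero_mul (f : ℝ → ℝ≥0∞) {h : ℝ} (hh : 0 ≤ h) (n : ℕ) :
    ∫⁻ t in Ioc (0 : ℝ) (n * h), f t =
      ∑ j ∈ Finset.range n, ∫⁻ t in Ioc (0 : ℝ) h, f (t + j * h) := by
  induction n with
  | zero => simp
  | succ n ih =>
    rw [Finset.sum_range_succ, ← ih, ← Ioc_union_Ioc_eq_Ioc (b := n * h) (by positivity)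
      (by push_cast; nlinarith), lintegral_union measurableSet_Ioc (Ioc_disjoint_Ioc_of_le le_rfl)]
    congr 1
    have := lintegral_comp_affine one_pos (n * h) 0 h f
    simp only [ENNReal.ofReal_one, one_mul, zero_add] at this
    rw [this]
    congr 3
    push_cast
    ring

/-- A bound on the quadratic sums is a bound on the kinetic energy. -/
lemma QuadraticSumLE.kineticEnergy_le {Γ : ℝ → X} {k : ℝ≥0∞} (hk : k < ⊤)
    (h : QuadraticSumLE Γ k) :
    ACOn Γ 0 1 ∧ ∫⁻ t in Icc (0 : ℝ) 1, metricSpeed Γ t ^ 2 ≤ k := by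
  have hΓ := h.continuous hk
  set q : ℕ → ℝ → ℝ≥0∞ := fun N t =>
    edist (Γ (t + 1 / ((N : ℝ) + 1))) (Γ t) / edist (t + 1 / ((N : ℝ) + 1)) t with hq
  have hN : ∀ N : ℕ, (0 : ℝ) < 1 / ((N : ℝ) + 1) := fun N => by positivity
  have hed : ∀ (N : ℕ) (t : ℝ), edist (t + 1 / ((N : ℝ) + 1)) t =
      ENNReal.ofReal (1 / ((N : ℝ) + 1)) := fun N t => by
    rw [edist_dist, Real.dist_eq, add_sub_cancel_left, abs_of_pos (hN N)]
  have hqm : ∀ N, Measurable (q N) := fun N => by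
    simp only [hq, hed]
    refine Measurable.div_const ?_ _
    exact ((hΓ.comp (continuous_add_const _)).edist hΓ).measurable
  set g : ℝ → ℝ≥0∞ := fun t => liminf (fun N => q N t) atTop with hg
  have hgm : Measurable g := .liminf hqm
  have hqint : ∀ N, ∫⁻ t in Ioc (0 : ℝ) 1, q N t ^ 2 ≤ k := by
    intro N
    set η := 1 / ((N : ℝ) + 1) with hη
    have hη0 : 0 < η := hN N
    have h1 : (1 : ℝ) = ((N + 1 : ℕ) : ℝ) * η := by
      rw [hη]
      push_cast
      field_simp
    have hofη : ENNReal.ofReal η ≠ 0 := by simpa using hη0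
    have hmeas : ∀ j ∈ Finset.range (N + 1), Measurable fun t => q N (t + j * η) ^ 2 := fun j _ =>
      ((hqm N).pow_const 2).comp (measurable_add_const _)
    rw [h1, lintegral_Ioc_zero_mul _ hη0.le, ← lintegral_finsetSum _ hmeas]
    -- For fixed `t` the intervals of length `η` starting at `t + j η` are disjoint, so the
    -- hypothesis applies to them. Integrating over `t` in one cell of length `η` recovers the whole
    -- integral with bound `k`.
    have hpt : ∀ t, ∑ j ∈ Finset.range (N + 1), q N (t + j * η) ^ 2 ≤ k / ENNReal.ofReal η := by
      intro t
      have hsum := h (N + 1) (fun j => (t + j * η, t + j * η + η)) ?_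
      · rw [ENNReal.le_div_iff_mul_le (Or.inl hofη) (Or.inl ENNReal.ofReal_ne_top),
          Finset.sum_mul]
        refine le_trans (Finset.sum_le_sum fun j _ => le_of_eq ?_) hsum
        simp only [hq]
        rw [hed, edist_comm (t + j * η) (t + j * η + η), hη, hed, ← hη,
          edist_comm (Γ (t + j * η)) (Γ (t + j * η + η)), div_eq_mul_inv, mul_pow,
          div_eq_mul_inv, mul_assoc, sq (ENNReal.ofReal η)⁻¹, mul_assoc,
          ENNReal.inv_mul_cancel hofη ENNReal.ofReal_ne_top, mul_one]
      · intro i _ j _ hij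
        have aux : ∀ i j : ℕ, i < j → Disjoint (Ioc (t + i * η) (t + i * η + η))
            (Ioc (t + j * η) (t + j * η + η)) := by
          intro i j hij
          refine Ioc_disjoint_Ioc_of_le ?_
          have : ((i : ℝ) + 1) ≤ j := by exact_mod_cast hij
          nlinarith
        simp only [Function.onFun]
        rw [uIoc_of_le (by linarith), uIoc_of_le (by linarith)]
        rcases lt_or_gt_of_ne hij with hlt | hlt
        · exact aux i j hlt
        · exact (aux j i hlt).symm
    calc ∫⁻ t in Ioc 0 η, ∑ j ∈ Finset.range (N + 1), q N (t + j * η) ^ 2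
        ≤ ∫⁻ _ in Ioc 0 η, k / ENNReal.ofReal η := lintegral_mono hpt
      _ = k := by
        rw [lintegral_const, Measure.restrict_apply_univ, Real.volume_Ioc, sub_zero,
          ENNReal.div_mul_cancel hofη ENNReal.ofReal_ne_top]
  have hgint : ∫⁻ t in Ioc (0 : ℝ) 1, g t ^ 2 ≤ k := by
    calc ∫⁻ t in Ioc (0 : ℝ) 1, g t ^ 2
        = ∫⁻ t in Ioc (0 : ℝ) 1, liminf (fun N => q N t ^ 2) atTop := by
          congr 1
          ext t
          simpa using sq_liminf_div (f := fun N => q N t) 1 one_ne_zero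
      _ ≤ liminf (fun N => ∫⁻ t in Ioc (0 : ℝ) 1, q N t ^ 2) atTop :=
          lintegral_liminf_le fun N => (hqm N).pow_const 2
      _ ≤ liminf (fun _ : ℕ => k) atTop := liminf_le_liminf (.of_forall hqint)
      _ = k := liminf_const k
  have hd : ∀ s t : ℝ, s ≤ t → edist (Γ s) (Γ t) ≤ ∫⁻ r in Ioc s t, g r := by
    intro s t hst
    refine (edist_le_lintegral_of_frequently hst (h.absolutelyContinuous hk s t)
      (.of_forall fun r _ C hC => ?_)).1
    -- The liminf controls the quotients for infinitely many steps only, which is why the frequent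
    -- form of the increment bound is used.
    have hfr : ∃ᶠ N in atTop, q N r < ENNReal.ofReal C := frequently_lt_of_liminf_lt (h := hC)
    have htend : Tendsto (fun N : ℕ => r + 1 / ((N : ℝ) + 1)) atTop (𝓝[≠] r) := by
      refine tendsto_nhdsWithin_iff.2 ⟨?_, .of_forall fun N => ?_⟩
      · simpa using tendsto_one_div_add_atTop_nhds_zero_nat.const_add r
      · simpa using (hN N).ne'
    refine htend.frequently (hfr.mono fun N hlt => ?_)
    simp only [hq] at hlt
    rw [hed, edist_dist, ← ENNReal.ofReal_div_of_pos (hN N)] at hlt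
    have hC0 : 0 < C := by
      by_contra! hC0
      rw [ENNReal.ofReal_of_nonpos hC0] at hlt
      exact not_lt_bot hlt
    rw [ENNReal.ofReal_lt_ofReal_iff hC0, div_lt_iff₀ (hN N)] at hlt
    rw [add_sub_cancel_left, abs_of_pos (hN N)]
    exact hlt.le
  obtain ⟨hAC, hspeed⟩ := ACOn_of_edist_le_lintegral hgm (hgint.trans_lt hk)
    fun s t _ hst _ => hd s t hst
  refine ⟨hAC, le_trans (lintegral_mono_ae ?_) ((lintegral_Icc_eq_Ioc _ 0 1).le.trans hgint)⟩
  filter_upwards [hspeed] with t ht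
  gcongr

end QuadraticVariation

/-! ### Compactness, lower semicontinuity and existence of minimizers. -/

section DirectMethod

variable {X : Type*} [MetricSpace X] {E : X → EReal}

/-- The sequential convergence of a topology as in `WeakTopologyAssumption`. -/
structure IsWeakConvergence (E : X → EReal) (Conv : (ℕ → X) → X → Prop) : Prop where
  const : ∀ x, Conv (fun _ => x) x
  comp : ∀ u x (ρ : ℕ → ℕ), Conv u x → Tendsto ρ atTop atTop → Conv (fun n => u (ρ n)) x
  congr : ∀ u v x, Conv u x → u =ᶠ[atTop] v → Conv v x
  unique : ∀ u x y, Conv u x → Conv u y → x = y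
  of_subseq : ∀ u x, (∀ ns : ℕ → ℕ, Tendsto ns atTop atTop →
    ∃ ms : ℕ → ℕ, Conv (fun n => u (ns (ms n))) x) → Conv u x
  compact : ∀ u : ℕ → X, Bornology.IsBounded (range u) →
    ∃ (z : X) (φ : ℕ → ℕ), StrictMono φ ∧ Conv (fun n => u (φ n)) z
  edist_le : ∀ (u v : ℕ → X) (x y : X), Conv u x → Conv v y →
    edist x y ≤ liminf (fun n => edist (u n) (v n)) atTop
  slope_le : ∀ (u : ℕ → X) (x : X), Conv u x →
    metricSlope E x ≤ liminf (fun n => metricSlope E (u n)) atTop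

/-- Only sequences are needed, so `σ` is forgotten and does not compete with the metric topology.
The Hausdorff property enters as uniqueness of limits. -/
lemma WeakTopologyAssumption.exists_isWeakConvergence (hσ : WeakTopologyAssumption E) :
    ∃ Conv, IsWeakConvergence E Conv := by
  obtain ⟨σ, hT2, hcpt, hd, hs⟩ := hσ
  exact ⟨fun u x => Tendsto u atTop (@nhds X σ x), fun _ => tendsto_const_nhds,
    fun _ _ _ hu hρ => hu.comp hρ, fun _ _ _ hu huv => hu.congr' huv,
    fun _ _ _ hx hy => tendsto_nhds_unique hx hy, fun _ _ h => tendsto_of_subseq_tendsto h,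
    hcpt, hd, hs⟩

variable {Conv : (ℕ → X) → X → Prop}

/-- The slope is lower semicontinuous for the metric topology, since metric convergence implies
weak convergence along a subsequence. -/
lemma IsWeakConvergence.lowerSemicontinuous_metricSlope (hW : IsWeakConvergence E Conv) :
    LowerSemicontinuous (metricSlope E) := by
  intro x c hc
  by_contra hcon
  obtain ⟨v, hv, hvc⟩ := exists_seq_forall_of_frequently (not_eventually.1 hcon)
  obtain ⟨z, φ, hφ, hz⟩ := hW.compact v (Metric.isBounded_range_of_tendsto v hv)
  -- Semicontinuity of `d` against a constant sequence identifies the weak limit with the metric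
  -- one.
  have hzx : z = x := by
    have h1 := hW.edist_le _ _ z x hz (hW.const x)
    have h2 : Tendsto (fun n => edist (v (φ n)) x) atTop (𝓝 0) := by
      have := (hv.comp hφ.tendsto_atTop).edist (tendsto_const_nhds (x := x))
      simpa using this
    rw [h2.liminf_eq] at h1
    exact edist_le_zero.1 h1
  subst hzx
  have h3 := hW.slope_le _ _ hz
  have h4 : liminf (fun n => metricSlope E (v (φ n))) atTop ≤ c := by
    refine (liminf_le_liminf (v := fun _ => c) (.of_forall fun n => ?_)).trans_eq (liminf_const c)
    exact not_lt.1 (hvc (φ n))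
  exact absurd (hc.trans_le (h3.trans h4)) (lt_irrefl _)

/-- Diagonal extraction for countably many properties of subsequences. -/
lemma exists_diagonal_subsequence {p : ℕ → (ℕ → ℕ) → Prop}
    (hex : ∀ k φ, StrictMono φ → ∃ θ : ℕ → ℕ, StrictMono θ ∧ p k (φ ∘ θ))
    (htail : ∀ k φ ψ, p k φ → (∃ ρ : ℕ → ℕ, Tendsto ρ atTop atTop ∧
      ∀ᶠ n in atTop, ψ n = φ (ρ n)) → p k ψ) :
    ∃ φ : ℕ → ℕ, StrictMono φ ∧ ∀ k, p k φ := by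
  choose! θ hθ hp using hex
  let Ψ : ℕ → ℕ → ℕ := fun k => Nat.rec id (fun k φ => φ ∘ θ k φ) k
  have hΨs : ∀ k, Ψ (k + 1) = Ψ k ∘ θ k (Ψ k) := fun k => rfl
  have hΨ : ∀ k, StrictMono (Ψ k) := by
    intro k
    induction k with
    | zero => exact strictMono_id
    | succ k ih => exact ih.comp (hθ k _ ih)
  have hfac : ∀ k j, ∃ ρ : ℕ → ℕ, StrictMono ρ ∧ Ψ (k + j) = Ψ k ∘ ρ := by
    intro k j
    induction j with
    | zero => exact ⟨id, strictMono_id, rfl⟩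
    | succ j ih =>
      obtain ⟨ρ, hρ, h⟩ := ih
      refine ⟨ρ ∘ θ (k + j) (Ψ (k + j)), hρ.comp (hθ _ _ (hΨ _)), ?_⟩
      rw [← add_assoc, hΨs]
      rw [← Function.comp_assoc, ← h]
  refine ⟨fun n => Ψ n n, strictMono_nat_of_lt_succ fun n => ?_, fun k => ?_⟩
  · rw [hΨs]
    exact hΨ n (lt_of_lt_of_le (Nat.lt_succ_self n) ((hθ n _ (hΨ n)).id_le (n + 1)))
  · refine htail k (Ψ (k + 1)) _ (hp k _ (hΨ k)) ?_
    choose ρ hρ hfac using hfac (k + 1)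
    refine ⟨fun n => ρ (n - (k + 1)) n,
      tendsto_atTop_mono (fun n => (hρ _).id_le n) tendsto_id, ?_⟩
    filter_upwards [eventually_ge_atTop (k + 1)] with n hn
    have := congrFun (hfac (n - (k + 1))) n
    rwa [Nat.add_sub_cancel' hn] at this

/-- Equi-Hölder curves with a common starting point have a pointwise convergent subsequence. -/
lemma IsWeakConvergence.exists_pointwise_limit (hW : IsWeakConvergence E Conv)
    {c : ℕ → ℝ → X} {x : X} {A : ℝ} (h0 : ∀ n, c n 0 = x)
    (hc : ∀ n s t, dist (c n s) (c n t) ^ 2 ≤ A * |s - t|) :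
    ∃ (Γ : ℝ → X) (φ : ℕ → ℕ), StrictMono φ ∧
      ∀ t, Conv (fun n => c (φ n) t) (Γ t) := by
  have hsub : ∀ (t : ℝ) (ψ : ℕ → ℕ), ∃ (z : X) (θ : ℕ → ℕ), StrictMono θ ∧
      Conv (fun n => c (ψ (θ n)) t) z := by
    intro t ψ
    have hb : Bornology.IsBounded (range fun n => c (ψ n) t) := by
      refine (Metric.isBounded_closedBall (x := x) (r := √(A * |t - 0|))).subset ?_
      rintro _ ⟨n, rfl⟩
      have := hc (ψ n) t 0
      rw [h0] at this
      exact Metric.mem_closedBall.2 (Real.le_sqrt_of_sq_le this)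
    exact hW.compact _ hb
  obtain ⟨φ, hφ, hφc⟩ := exists_diagonal_subsequence
    (p := fun k φ => ∃ z, Conv (fun n => c (φ n) (TopologicalSpace.denseSeq ℝ k)) z) (fun k φ _ => by
        obtain ⟨z, θ, hθ, hz⟩ := hsub (TopologicalSpace.denseSeq ℝ k) φ
        exact ⟨θ, hθ, z, hz⟩)
    (fun k φ ψ ⟨z, hz⟩ ⟨ρ, hρ, hev⟩ => ⟨z, hW.congr _ _ _ (hW.comp _ _ _ hz hρ) (by
        filter_upwards [hev] with n hn
        simp only [hn])⟩)
  choose z hz using hφc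
  have hclose : ∀ (t : ℝ) (ψ : ℕ → ℕ) (y : X), Tendsto ψ atTop atTop →
      Conv (fun n => c (φ (ψ n)) t) y →
      ∀ k, dist y (z k) ≤ √(A * |t - TopologicalSpace.denseSeq ℝ k|) := by
    intro t ψ y hψ hy k
    have h1 := hW.edist_le _ _ _ _ hy (hW.comp _ _ _ (hz k) hψ)
    rw [dist_edist]
    refine ENNReal.toReal_le_of_le_ofReal (Real.sqrt_nonneg _) (h1.trans ?_)
    refine (liminf_le_liminf (v := fun _ => ENNReal.ofReal
      √(A * |t - TopologicalSpace.denseSeq ℝ k|)) (.of_forall fun n => ?_)).trans_eq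
      (liminf_const _)
    rw [edist_dist]
    exact ENNReal.ofReal_le_ofReal (Real.le_sqrt_of_sq_le (hc _ _ _))
  -- Two cluster points at time `t` both lie within `√(A |t - s|)` of the limit at any `s` in the
  -- dense sequence, and `s` can be taken arbitrarily close to `t`. So convergence at countably many
  -- times gives convergence at all times.
  have huniq : ∀ (t : ℝ) (ψ ψ' : ℕ → ℕ) (y y' : X), Tendsto ψ atTop atTop →
      Tendsto ψ' atTop atTop → Conv (fun n => c (φ (ψ n)) t) y →
      Conv (fun n => c (φ (ψ' n)) t) y' → y = y' := by
    intro t ψ ψ' y y' hψ hψ' hy hy'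
    refine dist_le_zero.1 (le_of_forall_pos_lt_add fun ε hε => ?_)
    have hcont : Continuous fun s => 2 * √(A * |t - s|) := by fun_prop
    have hopen : IsOpen {s : ℝ | 2 * √(A * |t - s|) < ε} := isOpen_lt hcont continuous_const
    obtain ⟨_, hs, k, rfl⟩ := (TopologicalSpace.denseRange_denseSeq ℝ).inter_open_nonempty
      _ hopen ⟨t, by simpa using hε⟩
    have hs' : 2 * √(A * |t - TopologicalSpace.denseSeq ℝ k|) < ε := hs
    have h1 := hclose t ψ y hψ hy k
    have h2 := hclose t ψ' y' hψ' hy' k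
    have h3 := dist_triangle_right y y' (z k)
    linarith
  choose Γ θ hθ hΓ using fun t => hsub t φ
  refine ⟨Γ, φ, hφ, fun t => ?_⟩
  refine hW.of_subseq _ _ fun ns hns => ?_
  obtain ⟨y, θ', hθ', hy⟩ := hsub t (fun n => φ (ns n))
  refine ⟨θ', ?_⟩
  have : Γ t = y := huniq t (θ t) (fun n => ns (θ' n)) _ _ (hθ t).tendsto_atTop
    (hns.comp hθ'.tendsto_atTop) (hΓ t) hy
  rwa [this]

/-- Existence of a minimizer, once some competitor has finite action. -/
lemma schrodingerSolvable_of_action_lt_top (hσ : WeakTopologyAssumption E) {ε : ℝ} {x y : X}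
    (hfin : ∃ γ ∈ curvesJoining x y, schrodingerAction E ε γ < ⊤) :
    SchrodingerSolvable E ε x y := by
  obtain ⟨Conv, hW⟩ := hσ.exists_isWeakConvergence
  have hlsc := hW.lowerSemicontinuous_metricSlope
  set A := ⨅ γ ∈ curvesJoining x y, schrodingerAction E ε γ with hA
  have hAle : ∀ γ ∈ curvesJoining x y, A ≤ schrodingerAction E ε γ := fun γ hγ => iInf₂_le γ hγ
  have hAtop : A < ⊤ := by
    obtain ⟨γ, hγ, hlt⟩ := hfin
    exact (hAle γ hγ).trans_lt hlt
  have hmin : ∀ n : ℕ, ∃ γ ∈ curvesJoining x y,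
      schrodingerAction E ε γ < A + ((n : ℝ≥0∞) + 1)⁻¹ := by
    intro n
    have : A < A + ((n : ℝ≥0∞) + 1)⁻¹ := ENNReal.lt_add_right hAtop.ne (by simp)
    simpa only [hA, iInf_lt_iff, exists_prop] using this
  choose γ hγ hlt using hmin
  have hone : ∀ n : ℕ, ((n : ℝ≥0∞) + 1)⁻¹ ≤ 1 := fun n => by
    rw [ENNReal.inv_le_one]
    exact le_add_self
  have hkintop : ∀ n, kineticEnergy (γ n) ≤ A + 1 := fun n =>
    le_self_add.trans ((hlt n).le.trans (add_le_add le_rfl (hone n)))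
  have hA1 : A + 1 < ⊤ := ENNReal.add_lt_top.2 ⟨hAtop, ENNReal.one_lt_top⟩
  have hAC : ∀ n, ACOn (γ n) 0 1 := fun n => by
    by_contra hcon
    have := hkintop n
    rw [kineticEnergy, if_neg hcon] at this
    exact absurd hA1 (not_lt.2 this)
  set k : ℕ → ℝ≥0∞ := fun n => ∫⁻ t in Icc (0 : ℝ) 1, metricSpeed (γ n) t ^ 2 with hk
  have hkin : ∀ n, kineticEnergy (γ n) = 2⁻¹ * k n := fun n => by rw [kineticEnergy, if_pos (hAC n)]
  have hkle : ∀ n, k n ≤ 2 * (A + 1) := fun n => by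
    have := hkintop n
    rw [hkin] at this
    calc k n = 2 * (2⁻¹ * k n) := by
          rw [← mul_assoc, ENNReal.mul_inv_cancel two_ne_zero ENNReal.ofNat_ne_top, one_mul]
      _ ≤ _ := by gcongr
  have hB : 2 * (A + 1) < ⊤ := ENNReal.mul_lt_top ENNReal.ofNat_lt_top hA1
  set c : ℕ → ℝ → X := fun n t => γ n (clamp t) with hc
  have hcont : ∀ n, Continuous (c n) := fun n =>
    (hγ n).1.comp_continuous continuous_clamp clamp_mem
  have hQ : ∀ n, QuadraticSumLE (c n) (k n) := fun n => (hAC n).quadraticSumLE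
  have hQB : ∀ n, QuadraticSumLE (c n) (2 * (A + 1)) := fun n m I hI => (hQ n m I hI).trans (hkle n)
  have hc0 : ∀ n, c n 0 = x := fun n => by
    simp only [hc]
    rw [clamp_of_mem (by simp)]
    exact (hγ n).2.1
  have hc1 : ∀ n, c n 1 = y := fun n => by
    simp only [hc]
    rw [clamp_of_mem (by simp)]
    exact (hγ n).2.2
  obtain ⟨Γ, φ, hφ, hΓ⟩ := hW.exists_pointwise_limit hc0 fun n s t =>
    (hQB n).dist_sq_le hB s t
  have hΓQ : QuadraticSumLE Γ (liminf (fun n => k (φ n)) atTop) :=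
    QuadraticSumLE.of_liminf (c := fun n => c (φ n)) (fun n => hQ (φ n))
      fun s t => hW.edist_le _ _ _ _ (hΓ s) (hΓ t)
  have hlim_lt : liminf (fun n => k (φ n)) atTop < ⊤ :=
    ((liminf_le_liminf (v := fun _ => 2 * (A + 1)) (.of_forall fun n => hkle (φ n))).trans_eq
      (liminf_const _)).trans_lt hB
  obtain ⟨hΓAC, hΓkin⟩ := hΓQ.kineticEnergy_le hlim_lt
  have hΓ0 : Γ 0 = x := by
    have h := hΓ 0
    simp only [hc0] at h
    exact hW.unique _ _ _ h (hW.const _)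
  have hΓ1 : Γ 1 = y := by
    have h := hΓ 1
    simp only [hc1] at h
    exact hW.unique _ _ _ h (hW.const _)
  have hmem : Γ ∈ curvesJoining x y := ⟨hΓAC.continuousOn zero_le_one, hΓ0, hΓ1⟩
  have hfish : fisherInformation E Γ ≤ liminf (fun n => fisherInformation E (γ (φ n))) atTop := by
    have hFatou : ∫⁻ t in Icc (0 : ℝ) 1, metricSlope E (Γ t) ^ 2 ≤
        liminf (fun n => ∫⁻ t in Icc (0 : ℝ) 1, metricSlope E (γ (φ n) t) ^ 2) atTop := by
      calc ∫⁻ t in Icc (0 : ℝ) 1, metricSlope E (Γ t) ^ 2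
          ≤ ∫⁻ t in Icc (0 : ℝ) 1, liminf (fun n => metricSlope E (c (φ n) t) ^ 2) atTop := by
            refine lintegral_mono fun t => ?_
            have := sq_liminf_div (f := fun n => metricSlope E (c (φ n) t)) 1 one_ne_zero
            simp only [div_one] at this
            rw [← this]
            gcongr
            exact hW.slope_le _ _ (hΓ t)
        _ ≤ liminf (fun n => ∫⁻ t in Icc (0 : ℝ) 1, metricSlope E (c (φ n) t) ^ 2) atTop := by
            refine lintegral_liminf_le fun n => Measurable.pow_const ?_ 2
            -- The measurability required by Fatou comes from semicontinuity of the slope in the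
            -- metric topology.
            exact (show LowerSemicontinuous _ from hlsc.comp (hcont (φ n))).measurable
        _ = _ := by
            congr 1
            ext n
            refine setLIntegral_congr_fun measurableSet_Icc fun t ht => ?_
            simp only [hc, clamp_of_mem ht]
    have hcm : ∀ f : ℕ → ℝ≥0∞, 2⁻¹ * liminf f atTop = liminf (fun n => 2⁻¹ * f n) atTop :=
      fun f => (ENNReal.liminf_const_mul_of_ne_top (by simp)).symm
    simp only [fisherInformation]
    rw [← hcm]
    gcongr
  have hkinΓ : kineticEnergy Γ ≤ liminf (fun n => kineticEnergy (γ (φ n))) atTop := by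
    rw [kineticEnergy, if_pos hΓAC]
    simp only [hkin]
    rw [ENNReal.liminf_const_mul_of_ne_top (by simp)]
    gcongr
  have hact : schrodingerAction E ε Γ ≤ A := by
    calc schrodingerAction E ε Γ
        ≤ liminf (fun n => kineticEnergy (γ (φ n))) atTop +
          liminf (fun n => ENNReal.ofReal (ε ^ 2) * fisherInformation E (γ (φ n))) atTop := by
          rw [ENNReal.liminf_const_mul_of_ne_top ENNReal.ofReal_ne_top, schrodingerAction]
          gcongr
      _ ≤ liminf (fun n => schrodingerAction E ε (γ (φ n))) atTop := liminf_add_liminf_le _ _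
      _ ≤ liminf (fun n : ℕ => A + (((φ n : ℕ) : ℝ≥0∞) + 1)⁻¹) atTop :=
          liminf_le_liminf (.of_forall fun n => (hlt (φ n)).le)
      _ = A := by
          have h1 : Tendsto (fun n : ℕ => ((n : ℝ≥0∞) + 1)⁻¹) atTop (𝓝 0) := by
            have := (ENNReal.tendsto_inv_nat_nhds_zero).comp (tendsto_add_atTop_nat 1)
            simpa [Function.comp_def] using this
          have h2 := (h1.comp hφ.tendsto_atTop).const_add A
          rw [add_zero] at h2
          exact h2.liminf_eq
  exact ⟨Γ, hmem, hact.trans_lt hAtop, fun γ' hγ' => hact.trans (hAle γ' hγ')⟩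

end DirectMethod

/-! ### Finite action forces finite energy at the endpoints. -/

section FiniteEnergyEndpoints

variable {X : Type*} [MetricSpace X] {E : X → EReal}

/-- A sequence whose increments are controlled by the mass of dyadic annuli is bounded above. -/
lemma exists_bound_of_le_add_measure {N : Measure ℝ} [IsFiniteMeasure N] {e r : ℕ → ℝ} {C : ℝ}
    (hr : Antitone r) (hr0 : ∀ k, 0 ≤ r k) (hC : 0 ≤ C)
    (he : ∀ k, e (k + 1) ≤ e k + C * N.real (Ioc (r (k + 3)) (r k))) : ∃ B, ∀ k, e k ≤ B := by
  set Φ : ℕ → ℝ := fun k => N.real (Ioc 0 (r k)) with hΦ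
  have hsub : ∀ k, N.real (Ioc (r (k + 3)) (r k)) = Φ k - Φ (k + 3) := by
    intro k
    have h := measureReal_union (μ := N) (s₁ := Ioc 0 (r (k + 3))) (s₂ := Ioc (r (k + 3)) (r k))
      (Ioc_disjoint_Ioc_of_le le_rfl) measurableSet_Ioc
    rw [Ioc_union_Ioc_eq_Ioc (hr0 _) (hr (by omega))] at h
    simp only [hΦ]
    linarith
  have hnn : ∀ k, 0 ≤ Φ k := fun k => measureReal_nonneg
  -- Each interval spans three dyadic steps, so `Φ k - Φ (k + 3)` telescopes against a sum of three
  -- consecutive terms.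
  have hanti : ∀ k, e k + C * (Φ k + Φ (k + 1) + Φ (k + 2)) ≤
      e 0 + C * (Φ 0 + Φ 1 + Φ 2) := by
    intro k
    induction k with
    | zero => simp
    | succ k ih =>
      have := he k
      rw [hsub] at this
      have h1 : k + 1 + 1 = k + 2 := rfl
      have h2 : k + 1 + 2 = k + 3 := rfl
      rw [h1, h2]
      nlinarith
  refine ⟨e 0 + C * (Φ 0 + Φ 1 + Φ 2), fun k => ?_⟩
  have := hanti k
  have h1 : 0 ≤ C * (Φ k + Φ (k + 1) + Φ (k + 2)) :=
    mul_nonneg hC (add_nonneg (add_nonneg (hnn _) (hnn _)) (hnn _))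
  linarith

/-- The initial point of a curve with finite kinetic energy and finite Fisher information has finite
energy. -/
lemma energy_lt_top_of_finite_action (hE : Setting E) (hlsc : LowerSemicontinuous (metricSlope E))
    {γ : ℝ → X} (hcont : ContinuousOn γ (Icc 0 1)) (ν : Measure ℝ) [IsFiniteMeasure ν]
    (hd : ∀ s t : ℝ, 0 ≤ s → s ≤ t → t ≤ 1 →
      edist (γ s) (γ t) ^ 2 ≤ ENNReal.ofReal (t - s) * ν (Icc s t))
    (hs : ∫⁻ t in Icc (0 : ℝ) 1, metricSlope E (γ t) ^ 2 < ⊤) : E (γ 0) < ⊤ := by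
  obtain ⟨κ, hκ, hglob⟩ := hE.exists_energy_le_of_metricSlope
  set μ : Measure ℝ := (volume.restrict (Icc (0 : ℝ) 1)).withDensity
    (fun t => metricSlope E (γ t) ^ 2) with hμ
  have : IsFiniteMeasure μ := isFiniteMeasure_withDensity hs.ne
  -- `ν` controls squared distances and `μ` squared slopes; Lebesgue measure absorbs the `+ 1` in
  -- the global energy bound.
  set N : Measure ℝ := ν + μ + volume.restrict (Icc (0 : ℝ) 1) with hN
  have hμN : ∀ s, μ s ≤ N s := fun s => by
    simp only [hN, Measure.add_apply]
    exact le_add_right le_add_self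
  have hνN : ∀ s, ν s ≤ N s := fun s => by
    simp only [hN, Measure.add_apply]
    exact le_add_right le_self_add
  set r : ℕ → ℝ := fun k => (1 / 2) ^ k with hr
  have hrpos : ∀ k, 0 < r k := fun k => by positivity
  have hrsucc : ∀ k, r (k + 1) = r k / 2 := fun k => by
    simp only [hr, pow_succ]
    ring
  have hranti : Antitone r := antitone_nat_of_succ_le fun k => by
    rw [hrsucc]
    linarith [hrpos k]
  have hr1 : ∀ k, r k ≤ 1 := fun k => by simpa [hr] using hranti (Nat.zero_le k)
  have hIsub : ∀ k, Icc (r (k + 1)) (r k) ⊆ Icc 0 1 := fun k =>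
    Icc_subset_Icc (hrpos _).le (hr1 k)
  have hex : ∀ k, ∃ t ∈ Icc (r (k + 1)) (r k),
      ENNReal.ofReal (r (k + 1)) * metricSlope E (γ t) ^ 2 ≤ N (Icc (r (k + 1)) (r k)) := by
    intro k
    have hvol : volume (Icc (r (k + 1)) (r k)) = ENNReal.ofReal (r (k + 1)) := by
      rw [Real.volume_Icc]
      congr 1
      rw [hrsucc]
      ring
    have hne : ENNReal.ofReal (r (k + 1)) ≠ 0 := by simpa using hrpos (k + 1)
    obtain ⟨t, ht, hle⟩ := exists_le_setLAverage (μ := volume) (s := Icc (r (k + 1)) (r k))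
      (f := fun t => metricSlope E (γ t) ^ 2) (by rw [hvol]; exact hne)
      (by rw [hvol]; exact ENNReal.ofReal_ne_top)
      ((aemeasurable_comp_of_lowerSemicontinuous hlsc (hranti (Nat.le_succ k))
        (hcont.mono (hIsub k))).pow_const 2)
    refine ⟨t, ht, ?_⟩
    rw [setLAverage_eq, hvol, ENNReal.le_div_iff_mul_le (Or.inl hne)
      (Or.inl ENNReal.ofReal_ne_top), mul_comm] at hle
    refine hle.trans (le_trans (le_of_eq ?_) (hμN _))
    rw [hμ, withDensity_apply _ measurableSet_Icc, Measure.restrict_restrict measurableSet_Icc,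
      inter_eq_left.2 (hIsub k)]
  choose t ht hslope using hex
  have ht01 : ∀ k, t k ∈ Icc (0 : ℝ) 1 := fun k => hIsub k (ht k)
  have hfinite : ∀ k, metricSlope E (γ (t k)) < ⊤ := by
    intro k
    by_contra hcon
    have := hslope k
    rw [not_lt_top_iff.1 hcon, ENNReal.top_pow two_ne_zero,
      ENNReal.mul_top (by simpa using hrpos (k + 1))] at this
    exact absurd (measure_lt_top N _) (not_lt.2 this)
  set e : ℕ → ℝ := fun k => (E (γ (t k))).toReal with he
  set S : ℕ → ℝ := fun k => (metricSlope E (γ (t k))).toReal with hS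
  -- The slope is taken at the time nearer to `0`. With `n` the mass on the right, Young's
  -- inequality bounds each of `4 S d` and `4 d` by `10 n`, and the quadratic term is at most `κ n`.
  -- The left end is `r (k + 3)`, not `r (k + 2)`, so that the half-open interval contains the
  -- closed one `[r (k + 2), r k]`.
  have hstep : ∀ k, e (k + 1) ≤ e k + (20 + κ) * N.real (Ioc (r (k + 3)) (r k)) := by
    intro k
    set n := N.real (Ioc (r (k + 3)) (r k)) with hn
    set d := dist (γ (t (k + 1))) (γ (t k)) with hdk
    have hle : t (k + 1) ≤ t k := (ht (k + 1)).2.trans (ht k).1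
    have hr1k := hrsucc k
    have hr2k : r (k + 2) = r k / 4 := by rw [hrsucc, hrsucc]; ring
    have hr3k : r (k + 3) = r k / 8 := by rw [hrsucc, hr2k]; ring
    have hrk := hrpos k
    have htlow : r (k + 2) ≤ t (k + 1) := (ht (k + 1)).1
    have hb1 : r k / 4 * S (k + 1) ^ 2 ≤ n := by
      have h1 : ENNReal.ofReal (r (k + 2)) * metricSlope E (γ (t (k + 1))) ^ 2 ≤
          N (Ioc (r (k + 3)) (r k)) :=
        (hslope (k + 1)).trans (measure_mono fun s hs =>
          ⟨by have := hs.1; linarith [hrpos k], by have := hs.2; linarith⟩)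
      have h2 := ENNReal.toReal_mono (measure_ne_top N _) h1
      rw [ENNReal.toReal_mul, ENNReal.toReal_pow, ENNReal.toReal_ofReal (hrpos _).le, hr2k] at h2
      exact h2
    have hb2 : d ^ 2 ≤ r k * n := by
      have h1 : edist (γ (t (k + 1))) (γ (t k)) ^ 2 ≤
          ENNReal.ofReal (r k) * N (Ioc (r (k + 3)) (r k)) := by
        refine (hd _ _ (ht01 _).1 hle (ht01 _).2).trans (mul_le_mul' ?_ ?_)
        · exact ENNReal.ofReal_le_ofReal (by linarith [(ht k).2, (ht01 (k + 1)).1])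
        · exact (hνN _).trans (measure_mono fun s hs =>
            ⟨by linarith [hs.1], by linarith [hs.2, (ht k).2]⟩)
      have h2 := ENNReal.toReal_mono
        (ENNReal.mul_ne_top ENNReal.ofReal_ne_top (measure_ne_top N _)) h1
      rwa [ENNReal.toReal_mul, ENNReal.toReal_pow, ENNReal.toReal_ofReal hrk.le, ← dist_edist] at h2
    have hb3 : r k / 4 ≤ n := by
      have h1 : ENNReal.ofReal (r k / 4) ≤ N (Ioc (r (k + 3)) (r k)) := by
        calc ENNReal.ofReal (r k / 4) ≤ ENNReal.ofReal (r k - r (k + 3)) :=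
              ENNReal.ofReal_le_ofReal (by linarith)
          _ = volume (Ioc (r (k + 3)) (r k)) := Real.volume_Ioc.symm
          _ = volume.restrict (Icc 0 1) (Ioc (r (k + 3)) (r k)) := by
              rw [Measure.restrict_apply measurableSet_Ioc, inter_eq_left.2]
              exact fun s hs => ⟨(hrpos _).le.trans hs.1.le, hs.2.trans (hr1 k)⟩
          _ ≤ _ := by
              simp only [hN, Measure.add_apply]
              exact le_add_self
      have h2 := ENNReal.toReal_mono (measure_ne_top N _) h1
      rwa [ENNReal.toReal_ofReal (by positivity)] at h2
    have hg := hglob (γ (t (k + 1))) (γ (t k)) (hfinite _)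
      (lt_top_of_metricSlope_lt_top (hfinite k))
    have hd0 : 0 ≤ d := dist_nonneg
    have hdr : d ^ 2 / (r k / 4) ≤ 4 * n := by
      rw [div_le_iff₀ (by positivity)]
      linarith
    have hyoung : ∀ a : ℝ, 4 * a * d ≤ 2 * (r k / 4 * a ^ 2 + d ^ 2 / (r k / 4)) := by
      intro a
      have hq : 0 < r k / 4 := by positivity
      have : 0 ≤ (r k / 4 * a - d) ^ 2 / (r k / 4) := by positivity
      have heq : (r k / 4 * a - d) ^ 2 / (r k / 4) =
          r k / 4 * a ^ 2 - 2 * a * d + d ^ 2 / (r k / 4) := by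
        field_simp
        ring
      linarith
    have y1 := hyoung (S (k + 1))
    have y2 := hyoung 1
    have hn0 : 0 ≤ n := measureReal_nonneg
    have y3 : κ / 2 * d ^ 2 ≤ κ * n := by
      have h1 : d ^ 2 ≤ n := hb2.trans (mul_le_of_le_one_left hn0 (hr1 k))
      nlinarith [mul_le_mul_of_nonneg_left h1 hκ, mul_nonneg hκ hn0]
    simp only [he, hS] at *
    nlinarith
  obtain ⟨B, hB⟩ := exists_bound_of_le_add_measure hranti (fun k => (hrpos k).le)
    (show 0 ≤ 20 + κ by positivity) hstep
  by_contra hcon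
  -- If the limit energy were infinite, lower semicontinuity would push the energies at `t k` above
  -- the bound `B`.
  have hBlt : (B : EReal) < E (γ 0) := by
    rw [not_lt_top_iff.1 hcon]
    exact EReal.coe_lt_top B
  have htend : Tendsto t atTop (𝓝[Icc 0 1] 0) := by
    refine tendsto_nhdsWithin_iff.2 ⟨?_, .of_forall ht01⟩
    exact squeeze_zero (fun k => (ht01 k).1) (fun k => (ht k).2)
      (tendsto_pow_atTop_nhds_zero_of_lt_one (by norm_num) (by norm_num))
  have hγt : Tendsto (fun k => γ (t k)) atTop (𝓝 (γ 0)) :=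
    (hcont 0 (by simp)).tendsto.comp htend
  obtain ⟨k, hk⟩ := (hγt.eventually (hE.lsc (γ 0) B hBlt)).exists
  rw [← hE.coe_toReal (lt_top_of_metricSlope_lt_top (hfinite k)), gt_iff_lt, EReal.coe_lt_coe_iff] at hk
  exact absurd (hB k) (not_le.2 hk)

lemma energy_lt_top_of_schrodingerSolvable (hE : Setting E) (hσ : WeakTopologyAssumption E)
    {x y : X} {ε : ℝ} (hε : 0 < ε) (h : SchrodingerSolvable E ε x y) :
    E x < ⊤ ∧ E y < ⊤ ∧ ∃ γ : ℝ → X, ACOn γ 0 1 ∧ γ 0 = x ∧ γ 1 = y := by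
  obtain ⟨Conv, hW⟩ := hσ.exists_isWeakConvergence
  have hlsc := hW.lowerSemicontinuous_metricSlope
  obtain ⟨γ, ⟨hcont, h0, h1⟩, hfin, -⟩ := h
  obtain ⟨hkin, hfish⟩ := ENNReal.add_lt_top.1 hfin
  have hAC : ACOn γ 0 1 := by
    by_contra hcon
    rw [kineticEnergy, if_neg hcon] at hkin
    exact lt_irrefl _ hkin
  have hspeed : ∫⁻ t in Icc (0 : ℝ) 1, metricSpeed γ t ^ 2 < ⊤ := by
    rw [kineticEnergy, if_pos hAC] at hkin
    exact ENNReal.lt_top_of_mul_ne_top_right hkin.ne (by simp)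
  have hslope : ∫⁻ t in Icc (0 : ℝ) 1, metricSlope E (γ t) ^ 2 < ⊤ := by
    have := ENNReal.lt_top_of_mul_ne_top_right hfish.ne (by simpa using hε.ne')
    exact ENNReal.lt_top_of_mul_ne_top_right this.ne (by simp)
  set ν : Measure ℝ := (volume.restrict (Icc (0 : ℝ) 1)).withDensity
    (fun t => metricSpeed γ t ^ 2) with hν
  have : IsFiniteMeasure ν := isFiniteMeasure_withDensity hspeed.ne
  have hd : ∀ s t : ℝ, 0 ≤ s → s ≤ t → t ≤ 1 →
      edist (γ s) (γ t) ^ 2 ≤ ENNReal.ofReal (t - s) * ν (Icc s t) := by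
    intro s t hs hst ht
    refine (hAC.edist_sq_le hs hst ht).trans (mul_le_mul' le_rfl ?_)
    rw [hν, withDensity_apply _ measurableSet_Icc, Measure.restrict_restrict measurableSet_Icc,
      inter_eq_left.2 (Icc_subset_Icc hs ht)]
    exact lintegral_mono_set Ioc_subset_Icc_self
  refine ⟨?_, ?_, γ, hAC, h0, h1⟩
  · rw [← h0]
    exact energy_lt_top_of_finite_action hE hlsc hcont ν hd hslope
  · have hmeas : Measurable fun t : ℝ => 1 - t := measurable_const.sub measurable_id
    -- The other endpoint follows by time reversal. As increments are controlled by an abstract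
    -- measure, pushing it forward suffices and the speed of the reversed curve is not needed.
    have hrev := energy_lt_top_of_finite_action hE hlsc (γ := fun t => γ (1 - t))
      (hcont.comp (by fun_prop) fun t ht => ⟨by linarith [ht.2], by linarith [ht.1]⟩)
      (ν.map fun t => 1 - t) (fun s t hs hst ht => by
        rw [Measure.map_apply hmeas measurableSet_Icc, preimage_const_sub_Icc, edist_comm]
        have := hd (1 - t) (1 - s) (by linarith) (by linarith) (by linarith)
        rwa [show 1 - s - (1 - t) = t - s by ring] at this)
      (by
        rw [lintegral_Icc_eq_Ioc, lintegral_comp_one_sub 0 1 (fun t => metricSlope E (γ t) ^ 2)]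
        rw [lintegral_Icc_eq_Ioc] at hslope
        simpa using hslope)
    simpa [h1] using hrev

end FiniteEnergyEndpoints

end MetricSchrodinger

theorem proposition4p2 {X : Type*} [MetricSpace X] [CompleteSpace X]
    [TopologicalSpace.SeparableSpace X] (E : X → EReal)
    (hE : MetricSchrodinger.Setting E) (hσ : MetricSchrodinger.WeakTopologyAssumption E)
    (x y : X) (ε : ℝ) (hε : 0 < ε) :
    MetricSchrodinger.SchrodingerSolvable E ε x y ↔
      E x < ⊤ ∧ E y < ⊤ ∧ ∃ γ : ℝ → X, MetricSchrodinger.ACOn γ 0 1 ∧ γ 0 = x ∧ γ 1 = y := by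
  refine ⟨MetricSchrodinger.energy_lt_top_of_schrodingerSolvable hE hσ hε, ?_⟩
  rintro ⟨hx, hy, γ, hγ, rfl, rfl⟩
  exact MetricSchrodinger.schrodingerSolvable_of_action_lt_top hσ
    ((MetricSchrodinger.finiteJoin_of_ACOn hE hγ hx hy).exists_action_lt_top ε)
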